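/- **Theorem 3.6 (Klee–Walkup).** A *polyhedron* is an intersection of finitely many closed half-spaces of some $\mathbb{R}^m$, and a *$d$-polytope* is a non-empty bounded polyhedron $P$ whose affine hull has dimension $d$. A non-empty *face* of $P$ is a non-empty set of the form $P\cap\{x: \ell(x)=b\}$, where $\ell$ is a linear functional with $\ell\le b$ on $P$ (with $\ell = 0$ allowed, so $P$ is a face of itself); its dimension is that of its affine hull. *Vertices*, *edges* and *facets* are the faces of dimension $0$, $1$ and $d-1$. The *graph* $G(P)$ has the vertices of $P$ as nodes, two distinct vertices being adjacent when they lie in a common edge, and $\operatorname{diam}(G(P))$ is the maximum graph distance between two vertices. A $d$-polytope is *simple* if every vertex lies in exactly $d$ facets. The following three statements are equivalent. 1. (Hirsch conjecture) For all $n>d\ge 2$, every $d$-polytope $P$ with exactly $n$ facets satisfies $\operatorname{diam}(G(P))\le n-d$. 2. (Non-revisiting, or $W_v$, conjecture) For every simple polytope $P$ and all vertices $u,v$ of $P$ there is a path $u=x_0,x_1,\dots,x_\ell=v$ in $G(P)$ which at every step enters a facet not visited before: for each $0\le i<\ell$ there is a facet of $P$ that contains $x_{i+1}$ and none of $x_0,\dots,x_i$.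 3. ($d$-step conjecture) For every $d$ and every simple $d$-polytope $P$ with exactly $2d$ facets, any two vertices $u,v$ of $P$ that do not lie in a common facet are joined by a path of length $d$ in $G(P)$. -/

import Mathlib

namespace HirschConj

section Polytopes

variable {V : Type*} [NormedAddCommGroup V] [NormedSpace ℝ V]

/-- A polyhedron: an intersection of finitely many closed half-spaces `{x | l x ≤ b}`.
(A pair with `l = 0` cuts out the whole space or the empty set, so allowing such pairs does not
change which non-empty sets are polyhedra.) -/
def IsPolyhedron (P : Set V) : Prop :=
  ∃ s : Finset (StrongDual ℝ V × ℝ), P = {x | ∀ h ∈ s, h.1 x ≤ h.2}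

/-- The dimension of a non-empty set: the dimension of its affine hull. -/
noncomputable def dim (P : Set V) : ℕ :=
  Module.finrank ℝ (affineSpan ℝ P).direction

/-- `P` is a `d`-polytope: a non-empty bounded polyhedron of dimension `d`. -/
structure IsPolytope (d : ℕ) (P : Set V) : Prop where
  nonempty : P.Nonempty
  isPolyhedron : IsPolyhedron P
  isBounded : Bornology.IsBounded P
  dim_eq : dim P = d

/-- `F` is an `i`-face of `P`: a non-empty set of dimension `i` of the form `P ∩ {x | l x = b}`,
where the half-space `{x | l x ≤ b}` contains `P`. -/
structure IsFace (P : Set V) (i : ℕ) (F : Set V) : Prop where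
  nonempty : F.Nonempty
  isExposed : IsExposed ℝ P F
  dim_eq : dim F = i

/-- The facets of `P`: the faces of dimension `dim P - 1`. -/
def facets (P : Set V) : Set (Set V) :=
  {F | ∃ i, i + 1 = dim P ∧ IsFace P i F}

/-- The vertices of `P`: the points `x` such that `{x}` is a (0-dimensional) face of `P`. -/
abbrev Vertex (P : Set V) : Type _ := {x : V // IsFace P 0 {x}}

/-- The graph (1-skeleton) of `P`: two different vertices are adjacent when they are contained
in a common 1-face. -/
def graph (P : Set V) : SimpleGraph (Vertex P) where
  Adj u v := u ≠ v ∧ ∃ e : Set V, IsFace P 1 e ∧ u.1 ∈ e ∧ v.1 ∈ e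
  symm := ⟨fun _ _ h => ⟨h.1.symm, h.2.imp fun _ he => ⟨he.1, he.2.2, he.2.1⟩⟩⟩
  loopless := ⟨fun _ h => h.1 rfl⟩

/-- `P` is simple: every vertex lies in exactly `dim P` facets. -/
def IsSimple (P : Set V) : Prop :=
  ∀ v : Vertex P, {F | F ∈ facets P ∧ v.1 ∈ F}.encard = dim P

/-- Two vertices are complementary if they do not lie in a common facet. -/
def Complementary {P : Set V} (u v : Vertex P) : Prop :=
  ∀ F ∈ facets P, ¬ (u.1 ∈ F ∧ v.1 ∈ F)

/-- A walk `x₀, x₁, …` in the graph of `P` is non-revisiting if at every step, from `xᵢ` to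
`xᵢ₊₁`, it enters a facet that contains none of `x₀, …, xᵢ`. -/
def NonRevisiting {P : Set V} {u v : Vertex P} (p : (graph P).Walk u v) : Prop :=
  ∀ i < p.length, ∃ F ∈ facets P,
    (p.getVert (i + 1)).1 ∈ F ∧ ∀ j ≤ i, (p.getVert j).1 ∉ F

end Polytopes

/-- The Hirsch conjecture. The diameter is the `ℕ∞`-valued one, so that the inequality includes
its finiteness. -/
def HirschConjecture : Prop :=
  ∀ (n d m : ℕ) (P : Set (EuclideanSpace ℝ (Fin m))), 2 ≤ d → d < n →
    IsPolytope d P → (facets P).encard = n → (graph P).ediam ≤ ((n - d : ℕ) : ℕ∞)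

/-- The non-revisiting (`W_v`) conjecture. -/
def NonRevisitingConjecture : Prop :=
  ∀ (d m : ℕ) (P : Set (EuclideanSpace ℝ (Fin m))), IsPolytope d P → IsSimple P →
    ∀ u v : Vertex P, ∃ p : (graph P).Walk u v, p.IsPath ∧ NonRevisiting p

/-- The `d`-step conjecture. -/
def DStepConjecture : Prop :=
  ∀ (d m : ℕ) (P : Set (EuclideanSpace ℝ (Fin m))), IsPolytope d P → IsSimple P →
    (facets P).encard = (2 * d : ℕ) →
    ∀ u v : Vertex P, Complementary u v → ∃ p : (graph P).Walk u v, p.IsPath ∧ p.length = d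

end HirschConj

/-!
The three conjectures are compared through presentations of a polytope by linear inequalities and
equations, `IneqSystem`. For such a presentation the face structure is read off from the sets of
constraints that are tight at a point: the faces are the sets `face x` of points at which at least
the constraints tight at `x` are tight, and the dimension of `face x` is that of the common kernel
of those constraints. So a vertex is a point whose tight constraints have trivial common kernel,
and two vertices are adjacent when the constraints tight at both have a common kernel of
dimension one. If the presentation is irredundant (`IsProper`), facets correspond to constraints;
every polytope has an irredundant presentation (`exists_of_isPolytope`), and for a simple polytope
it is nondegenerate: the constraints tight at a point are independent (`IsNondegenerate`).

*Hirsch implies `d`-step.* On a simple polytope an edge enters exactly one facet, so a walk between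
complementary vertices has length at least `d`; the Hirsch bound for `2 * d` facets gives one of
length at most `d`.

*`d`-step implies non-revisiting.* The induction is on the number of constraints tight at neither
of the vertices `u` and `v`. If there are none, then in the smallest face containing `u` and `v`
these are complementary and there are `2 * d` facets. A path of length `d` enters `d` facets in
`d` steps, and all facets at `v` have to be among them, so no facet is entered twice. Otherwise let
`k` be a constraint tight at neither vertex, and take the wedge over it, the polytope of all
`(x, t)` with `0 ≤ t ≤ b k - a k x`. It is nondegenerate again (`wedge_isNondegenerate`), has one
more constraint, and the lift of `u` to its bottom and that of `v` to its top leave one constraint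
fewer uncovered. A non-revisiting path between the lifts projects to one from `u` to `v`
(`NewVisits.of_wedge`).

*Non-revisiting implies Hirsch.* On a simple polytope a non-revisiting path starts in `d` of the at
most `n` facets and enters a new one at each step, hence has length at most `n - d`. A general
polytope is perturbed to a simple one by moving the facets outwards by different powers of a small
`ε`. For generic `ε` the result is nondegenerate (`eventually_isNondegenerate`). By compactness, for
small `ε`, constraints that are simultaneously tight somewhere on the perturbed polytope are so on
the original one (`eventually_perturb_feasible`). This sends perturbed vertices to vertices and
perturbed edges to edges or vertices, and it reaches every vertex of the original polytope
(`eventually_exists_isVert_perturb`), so that the graph distances do not decrease.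
-/

set_option linter.unusedSectionVars false

namespace HirschConj

open Finset Module Filter Topology

/-! ### Systems of linear inequalities and the faces of their solution sets -/

/-- Finitely many weak linear inequalities `a i x ≤ b i`, indexed by `ι`, those with index in `E`
being required to hold with equality. The equations make it possible to treat polytopes that are
not full-dimensional, and faces of polytopes, in the ambient space. -/
structure IneqSystem (V : Type*) [NormedAddCommGroup V] [NormedSpace ℝ V] (ι : Type*) where
  a : ι → StrongDual ℝ V
  b : ι → ℝ
  E : Finset ι

namespace IneqSystem

section Basic

variable {V : Type*} [NormedAddCommGroup V] [NormedSpace ℝ V] {ι : Type*} (Q : IneqSystem V ι)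

/-- The solution set of the system. -/
def poly : Set V := {x | (∀ i, Q.a i x ≤ Q.b i) ∧ ∀ i ∈ Q.E, Q.a i x = Q.b i}

/-- The common kernel of the linear functionals with index in `S`. -/
def ker (S : Finset ι) : Submodule ℝ V where
  carrier := {w | ∀ i ∈ S, Q.a i w = 0}
  add_mem' hx hy i hi := by simp [hx i hi, hy i hi]
  zero_mem' i _ := by simp
  smul_mem' c x hx i hi := by simp [hx i hi]

variable {Q} in
theorem mem_ker {S : Finset ι} {w : V} : w ∈ Q.ker S ↔ ∀ i ∈ S, Q.a i w = 0 := Iff.rfl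

theorem ker_anti {S T : Finset ι} (h : S ⊆ T) : Q.ker T ≤ Q.ker S := fun _ hw i hi => hw i (h hi)

theorem convex_poly : Convex ℝ Q.poly := by
  have : Q.poly = (⋂ i, {x | Q.a i x ≤ Q.b i}) ∩ ⋂ i ∈ Q.E, {x | Q.a i x = Q.b i} := by
    ext x; simp [poly]
  rw [this]
  refine (convex_iInter fun i => convex_halfSpace_le (Q.a i).isLinear _).inter
    (convex_iInter₂ fun i _ => convex_hyperplane (Q.a i).isLinear _)

theorem isClosed_poly : IsClosed Q.poly := by
  have : Q.poly = (⋂ i, {x | Q.a i x ≤ Q.b i}) ∩ ⋂ i ∈ Q.E, {x | Q.a i x = Q.b i} := by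
    ext x; simp [poly]
  rw [this]
  exact (isClosed_iInter fun i => isClosed_le (Q.a i).continuous continuous_const).inter
    (isClosed_biInter fun i _ => isClosed_eq (Q.a i).continuous continuous_const)

variable [Fintype ι]

open Classical in
/-- The indices of the constraints that hold with equality at `x`. -/
noncomputable def tight (x : V) : Finset ι := {i | Q.a i x = Q.b i}

variable {Q}

@[simp]
theorem mem_tight {x : V} {i : ι} : i ∈ Q.tight x ↔ Q.a i x = Q.b i := by simp [tight]

theorem E_subset_tight {x : V} (hx : x ∈ Q.poly) : Q.E ⊆ Q.tight x := fun i hi =>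
  mem_tight.2 (hx.2 i hi)

theorem lt_of_notMem_tight {x : V} (hx : x ∈ Q.poly) {i : ι} (hi : i ∉ Q.tight x) :
    Q.a i x < Q.b i := lt_of_le_of_ne (hx.1 i) fun h => hi (mem_tight.2 h)

theorem sub_mem_ker {x y : V} {S : Finset ι} (hx : S ⊆ Q.tight x) (hy : S ⊆ Q.tight y) :
    x - y ∈ Q.ker S := fun i hi => by
  rw [map_sub, mem_tight.1 (hx hi), mem_tight.1 (hy hi), sub_self]

/-- From `x`, a short step in a direction that does not increase the tight constraints stays in the
solution set; exactly the tight constraints on which the direction vanishes stay tight. -/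
theorem exists_step {x w : V} (hx : x ∈ Q.poly) (hE : ∀ i ∈ Q.E, Q.a i w = 0)
    (hw : ∀ i ∈ Q.tight x, Q.a i w ≤ 0) :
    ∃ δ : ℝ, 0 < δ ∧ x + δ • w ∈ Q.poly ∧
      ∀ i, i ∈ Q.tight (x + δ • w) ↔ i ∈ Q.tight x ∧ Q.a i w = 0 := by
  have key : ∀ i, ∀ᶠ δ : ℝ in 𝓝[>] 0, i ∉ Q.tight x → Q.a i x + δ * Q.a i w < Q.b i := by
    intro i
    by_cases hi : i ∈ Q.tight x
    · simp [mem_tight.1 hi]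
    · have hc : Tendsto (fun δ : ℝ => Q.a i x + δ * Q.a i w) (𝓝[>] 0) (𝓝 (Q.a i x + 0 * Q.a i w)) :=
        tendsto_nhdsWithin_of_tendsto_nhds (by apply Continuous.tendsto; fun_prop)
      rw [zero_mul, add_zero] at hc
      filter_upwards [hc.eventually (gt_mem_nhds (lt_of_notMem_tight hx hi))] with δ h _ using h
  obtain ⟨δ, hδ, h0⟩ := ((eventually_all.2 key).and self_mem_nhdsWithin).exists
  have h0 : 0 < δ := h0
  refine ⟨δ, h0, ⟨fun i => ?_, fun i hi => ?_⟩, fun i => ?_⟩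
  · by_cases hi : i ∈ Q.tight x
    · have := mul_nonpos_of_nonneg_of_nonpos h0.le (hw i hi)
      rw [map_add, map_smul, smul_eq_mul, mem_tight.1 hi]; linarith
    · simpa using (hδ i hi).le
  · simp [hE i hi, hx.2 i hi]
  · by_cases hi : i ∈ Q.tight x
    · simp [mem_tight.1 hi, h0.ne']
    · have := hδ i hi
      simp only [hi, false_and, iff_false, mem_tight, map_add, map_smul, smul_eq_mul]
      exact this.ne

theorem tight_midpoint {x y : V} (hx : x ∈ Q.poly) (hy : y ∈ Q.poly) :
    midpoint ℝ x y ∈ Q.poly ∧ ∀ i, i ∈ Q.tight (midpoint ℝ x y) ↔ i ∈ Q.tight x ∧ i ∈ Q.tight y := by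
  refine ⟨Q.convex_poly.midpoint_mem hx hy, fun i => ?_⟩
  have h1 := hx.1 i
  have h2 := hy.1 i
  simp only [mem_tight, midpoint_eq_smul_add, map_smul, map_add, smul_eq_mul, invOf_eq_inv]
  constructor
  · intro h; constructor <;> linarith
  · rintro ⟨h, h'⟩; rw [h, h']; ring

variable (Q) in
/-- The smallest face containing the point `x`. -/
def face (x : V) : Set V := {y | y ∈ Q.poly ∧ Q.tight x ⊆ Q.tight y}

theorem mem_face_self {x : V} (hx : x ∈ Q.poly) : x ∈ Q.face x := ⟨hx, subset_rfl⟩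

/-- The sum of the functionals in `S` exposes the set where the constraints in `S` are tight. -/
theorem isExposed_setOf_tight (S : Finset ι) :
    IsExposed ℝ Q.poly {y | y ∈ Q.poly ∧ S ⊆ Q.tight y} := by
  rintro ⟨z, hz⟩
  refine ⟨∑ i ∈ S, Q.a i, ?_⟩
  have hle : ∀ y ∈ Q.poly, (∑ i ∈ S, Q.a i) y ≤ ∑ i ∈ S, Q.b i := fun y hy => by
    rw [_root_.sum_apply]; exact sum_le_sum fun i _ => hy.1 i
  have hz' : (∑ i ∈ S, Q.a i) z = ∑ i ∈ S, Q.b i := by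
    rw [_root_.sum_apply]
    exact sum_congr rfl fun i hi => mem_tight.1 (hz.2 hi)
  ext y
  refine and_congr_right fun hy => ⟨fun h w hw => ?_, fun h i hi => ?_⟩
  · have : (∑ i ∈ S, Q.a i) y = ∑ i ∈ S, Q.b i := by
      rw [_root_.sum_apply]
      exact sum_congr rfl fun i hi => mem_tight.1 (h hi)
    rw [this]; exact hle w hw
  · have h1 : (∑ i ∈ S, Q.a i) y = ∑ i ∈ S, Q.b i := le_antisymm (hle y hy) (hz' ▸ h z hz.1)
    rw [_root_.sum_apply] at h1
    exact mem_tight.2 ((sum_eq_sum_iff_of_le fun i _ => hy.1 i).1 h1 i hi)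

/-- A convex set of solutions has a point whose tight constraints are tight on the whole set. At a
midpoint only the constraints tight at both ends are tight, so an inclusion-minimal tight set is
the least one. -/
theorem exists_tight_subset {C : Set V} (hC : C.Nonempty) (hCP : C ⊆ Q.poly) (hconv : Convex ℝ C) :
    ∃ x ∈ C, ∀ y ∈ C, Q.tight x ⊆ Q.tight y := by
  obtain ⟨x, hx, hmin⟩ := exists_minimalFor_of_wellFoundedLT (fun y => y ∈ C)
    (fun y => Q.tight y) hC
  refine ⟨x, hx, fun y hy => ?_⟩
  have hm := tight_midpoint (hCP hx) (hCP hy)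
  have h1 := hmin (hconv.midpoint_mem hx hy) (fun i hi => ((hm.2 i).1 hi).1)
  exact fun i hi => ((hm.2 i).1 (h1 hi)).2

/-- Every exposed face is of the form `face x`: any relative interior point `x`, that is one with
a minimal tight set, will do. -/
theorem exists_eq_face {F : Set V} (hF : F.Nonempty) (hexp : IsExposed ℝ Q.poly F) :
    ∃ x ∈ Q.poly, F = Q.face x := by
  obtain ⟨x, hx, hmin⟩ := Q.exists_tight_subset hF hexp.subset (hexp.convex Q.convex_poly)
  have hxP := hexp.subset hx
  refine ⟨x, hxP, Set.Subset.antisymm (fun y hy => ⟨hexp.subset hy, hmin y hy⟩) ?_⟩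
  rintro y ⟨hy, hxy⟩
  obtain ⟨l, rfl⟩ := hexp hF
  refine ⟨hy, fun z hz => (hx.2 z hz).trans ?_⟩
  have hk : x - y ∈ Q.ker (Q.tight x) := sub_mem_ker subset_rfl hxy
  obtain ⟨δ, hδ, hP, -⟩ := Q.exists_step hxP (fun i hi => hk i (E_subset_tight hxP hi))
    (fun i hi => (hk i hi).le)
  have := hx.2 _ hP
  simp only [map_add, map_smul, map_sub, smul_eq_mul] at this
  nlinarith

theorem dim_face {x : V} (hx : x ∈ Q.poly) : dim (Q.face x) = finrank ℝ (Q.ker (Q.tight x)) := by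
  have : (affineSpan ℝ (Q.face x)).direction = Q.ker (Q.tight x) := by
    rw [direction_affineSpan]
    apply le_antisymm
    · rw [vectorSpan_def, Submodule.span_le]
      rintro _ ⟨y, hy, z, hz, rfl⟩
      exact sub_mem_ker hy.2 hz.2
    · intro w hw
      obtain ⟨δ, hδ, hP, ht⟩ := Q.exists_step hx (fun i hi => hw i (E_subset_tight hx hi))
        (fun i hi => (hw i hi).le)
      have h1 : x + δ • w ∈ Q.face x := ⟨hP, fun i hi => (ht i).2 ⟨hi, hw i hi⟩⟩
      have h2 := vsub_mem_vectorSpan ℝ h1 (mem_face_self hx)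
      rw [vsub_eq_sub, add_sub_cancel_left] at h2
      simpa [smul_smul, inv_mul_cancel₀ hδ.ne'] using
        (vectorSpan ℝ (Q.face x)).smul_mem δ⁻¹ h2
  rw [dim, this]

theorem isFace_iff {k : ℕ} {F : Set V} : IsFace Q.poly k F ↔
    ∃ x ∈ Q.poly, F = Q.face x ∧ finrank ℝ (Q.ker (Q.tight x)) = k := by
  constructor
  · rintro ⟨h1, h2, h3⟩
    obtain ⟨x, hx, rfl⟩ := Q.exists_eq_face h1 h2
    exact ⟨x, hx, rfl, by rw [← h3, dim_face hx]⟩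
  · rintro ⟨x, hx, rfl, rfl⟩
    exact ⟨⟨x, mem_face_self hx⟩, isExposed_setOf_tight _, dim_face hx⟩

variable (Q) in
/-- `x` is a vertex of the solution set: see `isFace_zero_iff`. -/
def IsVert (x : V) : Prop := x ∈ Q.poly ∧ Q.ker (Q.tight x) = ⊥

theorem eq_of_ker_eq_bot {x y : V} (h : Q.ker (Q.tight x) = ⊥) (hy : Q.tight x ⊆ Q.tight y) :
    y = x := by
  have := sub_mem_ker hy (subset_rfl : Q.tight x ⊆ Q.tight x)
  rwa [h, Submodule.mem_bot, sub_eq_zero] at this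

theorem dim_poly {x : V} (hx : x ∈ Q.poly) (ht : Q.tight x = Q.E) :
    dim Q.poly = finrank ℝ (Q.ker Q.E) := by
  have : Q.face x = Q.poly := Set.Subset.antisymm (fun y hy => hy.1)
    fun y hy => ⟨hy, ht ▸ E_subset_tight hy⟩
  rw [← this, dim_face hx, ht]

variable [FiniteDimensional ℝ V]

theorem isFace_zero_iff {x : V} : IsFace Q.poly 0 {x} ↔ Q.IsVert x := by
  rw [isFace_iff]
  constructor
  · rintro ⟨y, hy, h, hk⟩
    have : y = x := by have := mem_face_self hy; rwa [← h] at this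
    subst this
    exact ⟨hy, Submodule.finrank_eq_zero.1 hk⟩
  · rintro ⟨hx, hk⟩
    refine ⟨x, hx, ?_, by simp [hk]⟩
    ext y
    constructor
    · rintro rfl; exact mem_face_self hx
    · rintro ⟨-, h⟩; exact eq_of_ker_eq_bot hk h

theorem isVert_vertex (u : Vertex Q.poly) : Q.IsVert u.1 := isFace_zero_iff.1 u.2

variable [DecidableEq ι]

variable (Q) in
/-- Adjacency of vertices in terms of their tight sets: see `graph_adj_iff`. -/
def Adj (x y : V) : Prop := x ≠ y ∧ finrank ℝ (Q.ker (Q.tight x ∩ Q.tight y)) ≤ 1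

theorem finrank_eq_one_of_ne {S : Finset ι} {x y : V} (hxy : x ≠ y) (hx : S ⊆ Q.tight x)
    (hy : S ⊆ Q.tight y) (h : finrank ℝ (Q.ker S) ≤ 1) : finrank ℝ (Q.ker S) = 1 := by
  refine le_antisymm h (Nat.one_le_iff_ne_zero.2 fun h0 => hxy ?_)
  have := sub_mem_ker hx hy
  rwa [Submodule.finrank_eq_zero.1 h0, Submodule.mem_bot, sub_eq_zero] at this

theorem graph_adj_iff {u v : Vertex Q.poly} : (graph Q.poly).Adj u v ↔ Q.Adj u.1 v.1 := by
  have hu := (isVert_vertex u).1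
  have hv := (isVert_vertex v).1
  constructor
  · rintro ⟨hne, e, he, hue, hve⟩
    obtain ⟨x, hx, rfl, hk⟩ := isFace_iff.1 he
    exact ⟨fun h => hne (Subtype.ext h),
      hk ▸ Submodule.finrank_mono (Q.ker_anti (subset_inter hue.2 hve.2))⟩
  · rintro ⟨hne, hk⟩
    have hm := tight_midpoint hu hv
    have ht : Q.tight (midpoint ℝ u.1 v.1) = Q.tight u.1 ∩ Q.tight v.1 := by
      ext i; rw [hm.2, mem_inter]
    refine ⟨fun h => hne (congrArg _ h), Q.face (midpoint ℝ u.1 v.1), isFace_iff.2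
      ⟨_, hm.1, rfl, ?_⟩, ⟨hu, ht ▸ inter_subset_left⟩, ⟨hv, ht ▸ inter_subset_right⟩⟩
    rw [ht]
    exact finrank_eq_one_of_ne hne inter_subset_left inter_subset_right hk

end Basic

end IneqSystem

/-! ### Facets, nondegeneracy and presentations of polytopes -/

namespace IneqSystem

section Facets

variable {V : Type*} [NormedAddCommGroup V] [NormedSpace ℝ V] [FiniteDimensional ℝ V]
  {ι : Type*} [Fintype ι] [DecidableEq ι] {Q : IneqSystem V ι}

theorem ker_insert (i : ι) (S : Finset ι) :
    Q.ker (insert i S) = Q.ker S ⊓ LinearMap.ker (Q.a i).toLinearMap := by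
  ext w; simp [mem_ker, and_comm]

variable (Q) in
theorem finrank_ker_le_insert (i : ι) (S : Finset ι) :
    finrank ℝ (Q.ker S) ≤ finrank ℝ (Q.ker (insert i S)) + 1 := by
  have h1 := Submodule.finrank_sup_add_finrank_inf_eq (Q.ker S) (LinearMap.ker (Q.a i).toLinearMap)
  have h2 := LinearMap.finrank_range_add_finrank_ker (Q.a i).toLinearMap
  have h3 := Submodule.finrank_le (Q.ker S ⊔ LinearMap.ker (Q.a i).toLinearMap)
  have h4 := Submodule.finrank_le (LinearMap.range (Q.a i).toLinearMap)
  rw [finrank_self] at h4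
  rw [ker_insert]
  omega

theorem finrank_ker_insert {i : ι} {S : Finset ι} {w : V} (hw : w ∈ Q.ker S) (hi : Q.a i w ≠ 0) :
    finrank ℝ (Q.ker (insert i S)) + 1 = finrank ℝ (Q.ker S) := by
  refine le_antisymm (Submodule.finrank_lt_finrank_of_lt ?_) (Q.finrank_ker_le_insert i S)
  exact lt_of_le_of_ne (Q.ker_anti (subset_insert i S)) fun h =>
    hi ((h ▸ hw : w ∈ Q.ker (insert i S)) i (mem_insert_self i S))

variable (Q) in
theorem finrank_ker_le_union (S T : Finset ι) :
    finrank ℝ (Q.ker S) ≤ finrank ℝ (Q.ker (T ∪ S)) + #T := by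
  induction T using Finset.induction_on with
  | empty => rw [empty_union]; simp
  | insert i T hi ih =>
    rw [card_insert_of_notMem hi, insert_union]
    have := Q.finrank_ker_le_insert i (T ∪ S)
    omega

variable (Q) in
/-- The system has a point at which only the equations are tight, and each inequality that is tight
somewhere is tight alone at some point. Then the inequalities that are tight somewhere correspond
to the facets. Inequalities that are tight nowhere are allowed. -/
structure IsProper : Prop where
  interior : ∃ x ∈ Q.poly, Q.tight x = Q.E
  facet : ∀ i ∉ Q.E, ∀ x ∈ Q.poly, i ∈ Q.tight x → ∃ z ∈ Q.poly, Q.tight z = insert i Q.E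

variable (Q) in
/-- The part of the solution set where the constraint `i` is tight. -/
def facetOf (i : ι) : Set V := {y | y ∈ Q.poly ∧ i ∈ Q.tight y}

theorem face_eq_facetOf {i : ι} {z : V} (hz : Q.tight z = insert i Q.E) :
    Q.face z = Q.facetOf i := by
  ext y
  refine and_congr_right fun hy => ?_
  rw [hz, insert_subset_iff, and_iff_left (E_subset_tight hy)]

namespace IsProper

variable (hQ : Q.IsProper)
include hQ

theorem finrank_ker_insert_E {i : ι} (hi : i ∉ Q.E) {z : V} (hz : z ∈ Q.poly)
    (ht : Q.tight z = insert i Q.E) :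
    finrank ℝ (Q.ker (insert i Q.E)) + 1 = finrank ℝ (Q.ker Q.E) := by
  obtain ⟨x, hx, hxt⟩ := hQ.interior
  refine finrank_ker_insert (sub_mem_ker (E_subset_tight hx) (E_subset_tight hz)) ?_
  have h1 : i ∉ Q.tight x := hxt ▸ hi
  have h2 : i ∈ Q.tight z := ht ▸ mem_insert_self i _
  have := lt_of_notMem_tight hx h1
  rw [map_sub, mem_tight.1 h2]
  exact (sub_neg.2 this).ne

theorem dim_eq : dim Q.poly = finrank ℝ (Q.ker Q.E) := by
  obtain ⟨x, hx, hxt⟩ := hQ.interior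
  exact dim_poly hx hxt

theorem mem_facets {F : Set V} :
    F ∈ facets Q.poly ↔ ∃ i ∉ Q.E, (Q.facetOf i).Nonempty ∧ F = Q.facetOf i := by
  constructor
  · rintro ⟨k, hk, hF⟩
    obtain ⟨x, hx, rfl, hk'⟩ := isFace_iff.1 hF
    rw [hQ.dim_eq] at hk
    have hne : ¬ Q.tight x ⊆ Q.E := fun h => by
      have := Submodule.finrank_mono (Q.ker_anti h)
      omega
    obtain ⟨i, hi, hiE⟩ := not_subset.1 hne
    refine ⟨i, hiE, ⟨x, hx, hi⟩, ?_⟩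
    obtain ⟨z, hz, ht⟩ := hQ.facet i hiE x hx hi
    have h1 := hQ.finrank_ker_insert_E hiE hz ht
    have hsub : insert i Q.E ⊆ Q.tight x := insert_subset hi (E_subset_tight hx)
    have h2 : Q.ker (Q.tight x) = Q.ker (insert i Q.E) :=
      Submodule.eq_of_le_of_finrank_eq (Q.ker_anti hsub) (by omega)
    ext y
    refine and_congr_right fun hy => ⟨fun h => h hi, fun h j hj => ?_⟩
    have h3 : y - x ∈ Q.ker (Q.tight x) :=
      h2 ▸ sub_mem_ker (insert_subset h (E_subset_tight hy)) hsub
    have h4 := h3 j hj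
    rw [map_sub, mem_tight.1 hj, sub_eq_zero] at h4
    exact mem_tight.2 h4
  · rintro ⟨i, hi, ⟨x, hx, hxi⟩, rfl⟩
    obtain ⟨z, hz, ht⟩ := hQ.facet i hi x hx hxi
    refine ⟨_, ?_, isFace_iff.2 ⟨z, hz, (face_eq_facetOf ht).symm, rfl⟩⟩
    rw [hQ.dim_eq, ht, hQ.finrank_ker_insert_E hi hz ht]

theorem facetOf_injOn : Set.InjOn Q.facetOf {i | i ∉ Q.E ∧ (Q.facetOf i).Nonempty} := by
  rintro i ⟨hi, x, hx, hxi⟩ j ⟨hj, -⟩ hij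
  obtain ⟨z, hz, ht⟩ := hQ.facet i hi x hx hxi
  have h1 : z ∈ Q.facetOf j := hij ▸ ⟨hz, ht ▸ mem_insert_self i _⟩
  have h2 := h1.2
  rw [ht, mem_insert] at h2
  exact (h2.resolve_right hj).symm

theorem encard_facets_mem {x : V} (hx : x ∈ Q.poly) :
    {F | F ∈ facets Q.poly ∧ x ∈ F}.encard = #(Q.tight x \ Q.E) := by
  have : {F | F ∈ facets Q.poly ∧ x ∈ F} = Q.facetOf '' (Q.tight x \ Q.E : Finset ι) := by
    ext F
    constructor
    · rintro ⟨hF, hxF⟩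
      obtain ⟨i, hi, -, rfl⟩ := hQ.mem_facets.1 hF
      exact ⟨i, by simpa [hi] using hxF.2, rfl⟩
    · rintro ⟨i, hi, rfl⟩
      have hi := mem_sdiff.1 (mem_coe.1 hi)
      exact ⟨hQ.mem_facets.2 ⟨i, hi.2, ⟨x, hx, hi.1⟩, rfl⟩, hx, hi.1⟩
  rw [this, Set.InjOn.encard_image, Set.encard_coe_eq_coe_finsetCard]
  refine hQ.facetOf_injOn.mono fun i hi => ?_
  have hi := mem_sdiff.1 (mem_coe.1 hi)
  exact ⟨hi.2, x, hx, hi.1⟩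

theorem encard_facets (h : ∀ i ∉ Q.E, (Q.facetOf i).Nonempty) :
    (facets Q.poly).encard = #(Q.Eᶜ) := by
  have : facets Q.poly = Q.facetOf '' (Q.Eᶜ : Finset ι) := by
    ext F
    rw [hQ.mem_facets]
    constructor
    · rintro ⟨i, hi, -, rfl⟩
      exact ⟨i, by simpa using hi, rfl⟩
    · rintro ⟨i, hi, rfl⟩
      have hi : i ∉ Q.E := by simpa using hi
      exact ⟨i, hi, h i hi, rfl⟩
  rw [this, Set.InjOn.encard_image, Set.encard_coe_eq_coe_finsetCard]
  refine hQ.facetOf_injOn.mono fun i hi => ?_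
  have hi : i ∉ Q.E := by simpa using hi
  exact ⟨hi, h i hi⟩

end IsProper

variable (Q) in
/-- At each point, the functionals of the tight inequalities are linearly independent on the common
kernel of the equations, expressed through dual vectors: each tight constraint can be left while
staying on the others. -/
def IsNondegenerate : Prop :=
  ∀ x ∈ Q.poly, ∀ i ∈ Q.tight x, i ∉ Q.E →
    ∃ w, Q.a i w < 0 ∧ ∀ j ∈ Q.tight x, j ≠ i → Q.a j w = 0

namespace IsNondegenerate

variable (hQ : Q.IsNondegenerate)
include hQ

theorem finrank_ker_union {x : V} (hx : x ∈ Q.poly) {S : Finset ι} (hS : S ⊆ Q.tight x \ Q.E) :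
    finrank ℝ (Q.ker (S ∪ Q.E)) + #S = finrank ℝ (Q.ker Q.E) := by
  induction S using Finset.induction_on with
  | empty => rw [empty_union]; simp
  | insert i S hi ih =>
    obtain ⟨hiS, hS⟩ := insert_subset_iff.1 hS
    obtain ⟨hit, hiE⟩ := mem_sdiff.1 hiS
    obtain ⟨w, hw, hw'⟩ := hQ x hx i hit hiE
    have := ih hS
    rw [← this, insert_union, card_insert_of_notMem hi]
    have h2 : w ∈ Q.ker (S ∪ Q.E) := fun j hj => by
      rcases mem_union.1 hj with hj | hj
      · exact hw' j (mem_sdiff.1 (hS hj)).1 fun h => hi (h ▸ hj)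
      · exact hw' j (E_subset_tight hx hj) fun h => hiE (h ▸ hj)
    have := finrank_ker_insert h2 hw.ne
    omega

theorem finrank_ker {x : V} (hx : x ∈ Q.poly) {S : Finset ι} (hS : S ⊆ Q.tight x)
    (hE : Q.E ⊆ S) : finrank ℝ (Q.ker S) + #(S \ Q.E) = finrank ℝ (Q.ker Q.E) := by
  have := hQ.finrank_ker_union hx (sdiff_subset_sdiff hS (subset_refl Q.E))
  rwa [sdiff_union_of_subset hE] at this

theorem card_of_isVert {x : V} (hx : Q.IsVert x) :
    #(Q.tight x \ Q.E) = finrank ℝ (Q.ker Q.E) := by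
  have := hQ.finrank_ker hx.1 subset_rfl (E_subset_tight hx.1)
  rw [hx.2] at this
  simpa using this

theorem card_sdiff_of_adj {x y : V} (hx : Q.IsVert x) (hy : Q.IsVert y) (h : Q.Adj x y) :
    #(Q.tight y \ Q.tight x) = 1 := by
  have h1 := hQ.finrank_ker hx.1 inter_subset_left
    (subset_inter (E_subset_tight hx.1) (E_subset_tight hy.1))
  rw [finrank_eq_one_of_ne h.1 inter_subset_left inter_subset_right h.2, ← hQ.card_of_isVert hy,
    card_sdiff_of_subset (E_subset_tight hy.1), card_sdiff_of_subset
      (subset_inter (E_subset_tight hx.1) (E_subset_tight hy.1))] at h1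
  have h2 := card_sdiff_add_card_inter (Q.tight y) (Q.tight x)
  have h3 := card_le_card (subset_inter (E_subset_tight hx.1) (E_subset_tight hy.1))
  rw [inter_comm] at h2
  omega

/-- Any set of inequalities tight at a point can be left while staying on the other ones: move along
the sum of the dual vectors. -/
theorem exists_leave {x : V} (hx : x ∈ Q.poly) {S : Finset ι} (hS : S ⊆ Q.tight x)
    (hE : Q.E ⊆ S) : ∃ z ∈ Q.poly, Q.tight z = S := by
  choose! w hw hw' using hQ x hx
  have hval : ∀ j ∈ Q.tight x, Q.a j (∑ i ∈ Q.tight x \ S, w i) =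
      if j ∈ Q.tight x \ S then Q.a j (w j) else 0 := fun j hj => by
    rw [map_sum, ← sum_ite_eq (Q.tight x \ S) j fun i => Q.a j (w i)]
    refine sum_congr rfl fun i hi => ?_
    split_ifs with h
    · rfl
    · have hi := mem_sdiff.1 hi
      exact hw' i hi.1 (fun h => hi.2 (hE h)) j hj h
  obtain ⟨δ, -, hP, ht⟩ := Q.exists_step (w := ∑ i ∈ Q.tight x \ S, w i) hx (fun i hi => by
    rw [hval i (E_subset_tight hx hi), if_neg fun h => (Finset.mem_sdiff.1 h).2 (hE hi)])
    (fun i hi => by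
    rw [hval i hi]
    split_ifs with h
    · exact (hw i hi fun h' => (mem_sdiff.1 h).2 (hE h')).le
    · exact le_rfl)
  refine ⟨_, hP, ?_⟩
  ext i
  rw [ht]
  constructor
  · rintro ⟨hi, h0⟩
    by_contra hiS
    rw [hval i hi, if_pos (mem_sdiff.2 ⟨hi, hiS⟩)] at h0
    exact (hw i hi fun h' => hiS (hE h')).ne h0
  · intro hi
    exact ⟨hS hi, by rw [hval i (hS hi), if_neg fun h => (Finset.mem_sdiff.1 h).2 hi]⟩

theorem isProper (hne : Q.poly.Nonempty) : Q.IsProper where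
  interior := by
    obtain ⟨x, hx⟩ := hne
    exact hQ.exists_leave hx (E_subset_tight hx) subset_rfl
  facet i _ x hx hi :=
    hQ.exists_leave hx (insert_subset hi (E_subset_tight hx)) (subset_insert _ _)

theorem isSimple (hne : Q.poly.Nonempty) : IsSimple Q.poly := fun v => by
  rw [(hQ.isProper hne).encard_facets_mem (isVert_vertex v).1,
    hQ.card_of_isVert (isVert_vertex v), (hQ.isProper hne).dim_eq]

end IsNondegenerate

theorem isPolyhedron_poly : IsPolyhedron Q.poly := by
  classical
  refine ⟨univ.image (fun i => (Q.a i, Q.b i)) ∪ Q.E.image (fun i => (-Q.a i, -Q.b i)), ?_⟩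
  ext x
  simp only [Set.mem_ofPred_eq, mem_union, mem_image, poly, or_imp, forall_and,
    forall_exists_index, and_imp]
  constructor
  · rintro ⟨h1, h2⟩
    refine ⟨?_, ?_⟩
    · rintro _ i - rfl; exact h1 i
    · rintro _ i hi rfl; simp [h2 i hi]
  · rintro ⟨h1, h2⟩
    refine ⟨fun i => h1 _ i (mem_univ i) rfl, fun i hi => ?_⟩
    have := h2 _ i hi rfl
    simp only [_root_.neg_apply, neg_le_neg_iff] at this
    exact le_antisymm (h1 _ i (mem_univ i) rfl) this

theorem IsProper.isPolytope (hQ : Q.IsProper) (hb : Bornology.IsBounded Q.poly) :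
    IsPolytope (finrank ℝ (Q.ker Q.E)) Q.poly :=
  ⟨let ⟨x, hx, _⟩ := hQ.interior; ⟨x, hx⟩, isPolyhedron_poly, hb, hQ.dim_eq⟩

/-- Every face of a bounded solution set has a vertex. -/
theorem exists_isVert_of_mem (hb : Bornology.IsBounded Q.poly) {x : V} (hx : x ∈ Q.poly) :
    ∃ v, Q.IsVert v ∧ Q.tight x ⊆ Q.tight v := by
  have hexp : IsExposed ℝ Q.poly (Q.face x) := isExposed_setOf_tight _
  have hc : IsCompact (Q.face x) :=
    hexp.isCompact (Metric.isCompact_of_isClosed_isBounded Q.isClosed_poly hb)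
  obtain ⟨v, hv⟩ := hc.extremePoints_nonempty ⟨x, mem_face_self hx⟩
  refine ⟨v, ⟨hv.1.1, (Submodule.eq_bot_iff _).2 fun w hw => ?_⟩, hv.1.2⟩
  have hmem : ∀ w ∈ Q.ker (Q.tight v), ∃ δ : ℝ, 0 < δ ∧ v + δ • w ∈ Q.face x := fun w hw => by
    obtain ⟨δ, hδ, hP, ht⟩ := Q.exists_step hv.1.1
      (fun i hi => hw i (E_subset_tight hv.1.1 hi)) (fun i hi => (hw i hi).le)
    exact ⟨δ, hδ, hP, fun i hi => (ht i).2 ⟨hv.1.2 hi, hw i (hv.1.2 hi)⟩⟩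
  obtain ⟨δ, hδ, h1⟩ := hmem w hw
  obtain ⟨η, hη, h2⟩ := hmem (-w) (neg_mem hw)
  have h3 : v ∈ openSegment ℝ (v + δ • w) (v + η • -w) := by
    have hs : δ + η ≠ 0 := by positivity
    refine ⟨η / (δ + η), δ / (δ + η), by positivity, by positivity, ?_, ?_⟩
    · field_simp; ring
    · match_scalars
      · field_simp; ring
      · field_simp; ring
  have h4 := hv.2 h1 h2 h3
  simpa [hδ.ne'] using h4

theorem exists_isVert_isMax (hb : Bornology.IsBounded Q.poly) (hne : Q.poly.Nonempty)
    (c : StrongDual ℝ V) : ∃ v, Q.IsVert v ∧ ∀ y ∈ Q.poly, c y ≤ c v := by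
  obtain ⟨x, hx, hmax⟩ := (Metric.isCompact_of_isClosed_isBounded Q.isClosed_poly hb).exists_isMaxOn
    hne c.continuous.continuousOn
  have hexp : IsExposed ℝ Q.poly {y | y ∈ Q.poly ∧ ∀ z ∈ Q.poly, c z ≤ c y} := fun _ => ⟨c, rfl⟩
  obtain ⟨y, hy, hF⟩ := exists_eq_face (F := {y | y ∈ Q.poly ∧ ∀ z ∈ Q.poly, c z ≤ c y})
    ⟨x, hx, fun z hz => hmax hz⟩ hexp
  obtain ⟨v, hv, hyv⟩ := exists_isVert_of_mem hb hy
  have : v ∈ Q.face y := ⟨hv.1, hyv⟩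
  rw [← hF] at this
  exact ⟨v, hv, this.2⟩

/-- At a vertex of a simple polytope, `d` inequalities cut the `d`-dimensional kernel of the
equations down to zero, so they are independent; other points have fewer tight constraints. -/
theorem IsProper.isNondegenerate (hQ : Q.IsProper) (hb : Bornology.IsBounded Q.poly)
    (hs : IsSimple Q.poly) : Q.IsNondegenerate := by
  intro x hx i hi hiE
  obtain ⟨v, hv, hxv⟩ := exists_isVert_of_mem hb hx
  have hcard := hs ⟨v, isFace_zero_iff.2 hv⟩
  rw [hQ.encard_facets_mem hv.1, hQ.dim_eq] at hcard
  have hcard : #(Q.tight v \ Q.E) = finrank ℝ (Q.ker Q.E) := by exact_mod_cast hcard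
  have hiv : i ∈ Q.tight v \ Q.E := mem_sdiff.2 ⟨hxv hi, hiE⟩
  have h1 := Q.finrank_ker_le_union Q.E ((Q.tight v \ Q.E).erase i)
  have h2 : 0 < finrank ℝ (Q.ker ((Q.tight v \ Q.E).erase i ∪ Q.E)) := by
    rw [card_erase_of_mem hiv] at h1
    have := card_pos.2 ⟨i, hiv⟩
    omega
  have h3 : ∃ w ∈ Q.ker ((Q.tight v \ Q.E).erase i ∪ Q.E), w ≠ 0 := by
    by_contra! h
    rw [(Submodule.eq_bot_iff _).2 h] at h2
    simp at h2
  obtain ⟨w, hw, hw0⟩ := h3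
  have hw' : ∀ j ∈ Q.tight v, j ≠ i → Q.a j w = 0 := fun j hj hji => hw j <| by
    by_cases hjE : j ∈ Q.E
    · exact mem_union_right _ hjE
    · exact mem_union_left _ (mem_erase.2 ⟨hji, mem_sdiff.2 ⟨hj, hjE⟩⟩)
  have hi0 : Q.a i w ≠ 0 := fun h => hw0 <| by
    have : w ∈ Q.ker (Q.tight v) := fun j hj => by
      by_cases hji : j = i
      · rwa [hji]
      · exact hw' j hj hji
    rwa [hv.2] at this
  rcases lt_or_gt_of_ne hi0 with h | h
  · exact ⟨w, h, fun j hj => hw' j (hxv hj)⟩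
  · exact ⟨-w, by simpa using h, fun j hj hji => by simp [hw' j (hxv hj) hji]⟩

end Facets

/-- Every polytope has an irredundant presentation: take a description with as few half-spaces as
possible, and for `E` the constraints that are tight everywhere. -/
theorem exists_of_isPolytope {V : Type*} [NormedAddCommGroup V] [NormedSpace ℝ V]
    [FiniteDimensional ℝ V] {d : ℕ} {P : Set V} (hP : IsPolytope d P) :
    ∃ (s : Finset (StrongDual ℝ V × ℝ)) (_ : DecidableEq s) (Q : IneqSystem V s),
      Q.poly = P ∧ Q.IsProper ∧
      (∀ i ∉ Q.E, (Q.facetOf i).Nonempty) ∧ finrank ℝ (Q.ker Q.E) = d := by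
  classical
  obtain ⟨s, hs, hmin⟩ := exists_minimalFor_of_wellFoundedLT
    (fun s : Finset (StrongDual ℝ V × ℝ) => P = {x | ∀ h ∈ s, h.1 x ≤ h.2}) id hP.isPolyhedron
  let Q : IneqSystem V s := ⟨fun i => i.1.1, fun i => i.1.2, {i | ∀ x ∈ P, i.1.1 x = i.1.2}⟩
  have hQP : Q.poly = P := by
    ext x
    constructor
    · rintro ⟨h, -⟩
      rw [hs]
      exact fun i hi => h ⟨i, hi⟩
    · intro hx
      refine ⟨fun i => ?_, fun i hi => ?_⟩
      · have h := hx
        rw [hs] at h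
        exact h i.1 i.2
      · exact (mem_filter.1 hi).2 x hx
  have hsub : ∀ x ∈ P, (∀ y ∈ P, Q.tight x ⊆ Q.tight y) → Q.tight x = Q.E := fun x hx h =>
    Subset.antisymm (fun i hi => mem_filter.2 ⟨mem_univ _, fun y hy => mem_tight.1 (h y hy hi)⟩)
      (E_subset_tight (hQP ▸ hx))
  obtain ⟨x, hx, hxt⟩ := Q.exists_tight_subset (hQP ▸ hP.nonempty) subset_rfl Q.convex_poly
  have hxE := hsub x (hQP ▸ hx) (hQP ▸ hxt)
  have hfac : ∀ i ∉ Q.E, ∃ z ∈ Q.poly, Q.tight z = insert i Q.E := by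
    intro i hi
    have h1 : ¬ P = {x | ∀ h ∈ s.erase i.1, h.1 x ≤ h.2} := fun h => by
      have := hmin h (erase_subset _ _)
      exact notMem_erase i.1 s (this i.2)
    have h2 : ∃ y, (∀ j, j ≠ i → Q.a j y ≤ Q.b j) ∧ Q.b i < Q.a i y := by
      by_contra! hcon
      refine h1 (Set.Subset.antisymm (fun y hy => ?_) fun y hy => ?_)
      · rw [hs] at hy
        exact fun h hh => hy h (mem_of_mem_erase hh)
      · have h3 := hcon y fun j hj => hy j.1 (mem_erase.2 ⟨fun h => hj (Subtype.ext h), j.2⟩)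
        rw [hs]
        intro h hh
        by_cases hi : h = i.1
        · rw [hi]; exact h3
        · exact hy h (mem_erase.2 ⟨hi, hh⟩)
    obtain ⟨y, hy, hyi⟩ := h2
    have hxi : Q.a i x < Q.b i := lt_of_notMem_tight hx (hxE ▸ hi)
    set t := (Q.b i - Q.a i x) / (Q.a i y - Q.a i x) with ht
    have ht0 : 0 < t := div_pos (by linarith) (by linarith)
    have ht1 : t < 1 := (div_lt_one (by linarith)).2 (by linarith)
    have hzi : Q.a i (x + t • (y - x)) = Q.b i := by
      have : Q.a i y - Q.a i x ≠ 0 := by linarith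
      simp only [map_add, map_smul, map_sub, smul_eq_mul, ht]
      field_simp; ring
    have hzj : ∀ j, j ≠ i → Q.a j (x + t • (y - x)) ≤ Q.b j ∧
        (j ∉ Q.E → Q.a j (x + t • (y - x)) < Q.b j) := fun j hj => by
      have h1 := hy j hj
      have h2 := hx.1 j
      simp only [map_add, map_smul, map_sub, smul_eq_mul]
      refine ⟨by nlinarith, fun hjE => ?_⟩
      have h3 : Q.a j x < Q.b j := lt_of_notMem_tight hx (hxE ▸ hjE)
      nlinarith
    have hzP : x + t • (y - x) ∈ Q.poly := by
      rw [hQP, hs]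
      intro h hh
      by_cases hi : (⟨h, hh⟩ : s) = i
      · rw [← hi] at hzi; exact hzi.le
      · exact (hzj ⟨h, hh⟩ hi).1
    refine ⟨_, hzP, Subset.antisymm (fun j hj => ?_)
      (insert_subset (mem_tight.2 hzi) (E_subset_tight hzP))⟩
    by_contra hj'
    rw [mem_insert, not_or] at hj'
    exact ((hzj j hj'.1).2 hj'.2).ne (mem_tight.1 hj)
  have hprop : Q.IsProper := ⟨⟨x, hx, hxE⟩, fun i hi _ _ _ => hfac i hi⟩
  refine ⟨s, inferInstance, Q, hQP, hprop, fun i hi => ?_, ?_⟩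
  · obtain ⟨z, hz, hzt⟩ := hfac i hi
    exact ⟨z, hz, hzt ▸ mem_insert_self _ _⟩
  · rw [← hprop.dim_eq, hQP, hP.dim_eq]

end IneqSystem

/-! ### Walks and the constraints they visit -/

namespace IneqSystem

section Walks

variable {V : Type*} [NormedAddCommGroup V] [NormedSpace ℝ V] [FiniteDimensional ℝ V]
  {ι : Type*} [Fintype ι] [DecidableEq ι] {Q : IneqSystem V ι}

variable (Q) in
/-- `Q.Visits u l S y`: there is a walk of length `l` from `u` to `y` along vertices, and `S` is the
set of the constraints tight at some point of it. -/
inductive Visits (u : V) : ℕ → Finset ι → V → Prop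
  | refl : Visits u 0 (Q.tight u) u
  | step {l : ℕ} {S : Finset ι} {x y : V} : Visits u l S x → Q.IsVert y → Q.Adj x y →
      Visits u (l + 1) (S ∪ Q.tight y) y

variable (Q) in
/-- As `Visits`, with the walk visiting a new constraint at every step. -/
inductive NewVisits (u : V) : ℕ → Finset ι → V → Prop
  | refl : NewVisits u 0 (Q.tight u) u
  | step {l : ℕ} {S : Finset ι} {x y : V} : NewVisits u l S x → Q.IsVert y → Q.Adj x y →
      ¬ Q.tight y ⊆ S → NewVisits u (l + 1) (S ∪ Q.tight y) y

variable {u y : V} {l : ℕ} {S : Finset ι}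

theorem NewVisits.visits (h : Q.NewVisits u l S y) : Q.Visits u l S y := by
  induction h with
  | refl => exact .refl
  | step _ hy hxy _ ih => exact .step ih hy hxy

theorem Visits.tight_start_subset (h : Q.Visits u l S y) : Q.tight u ⊆ S := by
  induction h with
  | refl => exact subset_rfl
  | step _ _ _ ih => exact ih.trans subset_union_left

theorem Visits.tight_subset (h : Q.Visits u l S y) : Q.tight y ⊆ S := by
  cases h with
  | refl => exact subset_rfl
  | step => exact subset_union_right

theorem Visits.isVert (h : Q.Visits u l S y) (hu : Q.IsVert u) : Q.IsVert y := by
  cases h with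
  | refl => exact hu
  | step _ hy => exact hy

theorem NewVisits.card_le (h : Q.NewVisits u l S y) : #(Q.tight u) + l ≤ #S := by
  induction h with
  | refl => simp
  | @step l S x y _ _ _ hnew ih =>
    have : #S < #(S ∪ Q.tight y) := card_lt_card
      ⟨subset_union_left, fun h => hnew (subset_union_right.trans h)⟩
    omega

/-- In a nondegenerate system a step visits at most one new constraint, so that a walk visiting as
many constraints as its length permits visits a new one at every step. -/
theorem IsNondegenerate.card_le (hQ : Q.IsNondegenerate) (hu : Q.IsVert u)
    (h : Q.Visits u l S y) :
    #S ≤ #(Q.tight u) + l ∧ (#S = #(Q.tight u) + l → Q.NewVisits u l S y) := by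
  induction h with
  | refl => exact ⟨le_rfl, fun _ => .refl⟩
  | @step l S x y h hy hxy ih =>
    have h1 := hQ.card_sdiff_of_adj (h.isVert hu) hy hxy
    have h2 : #(Q.tight y \ S) ≤ 1 := h1 ▸ card_le_card (sdiff_subset_sdiff subset_rfl h.tight_subset)
    have h3 : #(S ∪ Q.tight y) = #S + #(Q.tight y \ S) := by
      rw [← card_union_of_disjoint disjoint_sdiff, union_sdiff_self_eq_union]
    refine ⟨by omega, fun h4 => .step (ih.2 (by omega)) hy hxy fun hsub => ?_⟩
    rw [sdiff_eq_empty_iff_subset.2 hsub, card_empty] at h3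
    omega

theorem visits_getVert {u v : Vertex Q.poly} (p : (graph Q.poly).Walk u v) :
    ∀ i ≤ p.length, ∃ S, Q.Visits u.1 i S (p.getVert i).1 := by
  intro i
  induction i with
  | zero => exact fun _ => ⟨_, by simpa using .refl⟩
  | succ i ih =>
    intro hi
    obtain ⟨S, hS⟩ := ih (by omega)
    exact ⟨_, .step hS (isVert_vertex _) (graph_adj_iff.1 (p.adj_getVert_succ (by omega)))⟩

theorem exists_visits {u v : Vertex Q.poly} (p : (graph Q.poly).Walk u v) :
    ∃ S, Q.Visits u.1 p.length S v.1 := by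
  simpa using visits_getVert p p.length le_rfl

theorem IsProper.exists_newVisits (hQ : Q.IsProper) {u v : Vertex Q.poly}
    (p : (graph Q.poly).Walk u v) (hp : NonRevisiting p) :
    ∃ S, Q.NewVisits u.1 p.length S v.1 := by
  have : ∀ i ≤ p.length, ∃ S, Q.NewVisits u.1 i S (p.getVert i).1 ∧
      ∀ k, k ∈ S → ∃ j ≤ i, k ∈ Q.tight (p.getVert j).1 := by
    intro i
    induction i with
    | zero =>
      exact fun _ => ⟨Q.tight u.1, by simpa using .refl, fun k hk => ⟨0, le_rfl, by simpa using hk⟩⟩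
    | succ i ih =>
      intro hi
      obtain ⟨S, hS, hS'⟩ := ih (by omega)
      refine ⟨_, .step hS (isVert_vertex _) (graph_adj_iff.1 (p.adj_getVert_succ (by omega))) ?_, ?_⟩
      · obtain ⟨F, hF, h1, h2⟩ := hp i (by omega)
        obtain ⟨k, -, -, rfl⟩ := hQ.mem_facets.1 hF
        intro hsub
        obtain ⟨j, hj, hk⟩ := hS' k (hsub h1.2)
        exact h2 j hj ⟨(isVert_vertex _).1, hk⟩
      · intro k hk
        rcases mem_union.1 hk with hk | hk
        · obtain ⟨j, hj, hk⟩ := hS' k hk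
          exact ⟨j, by omega, hk⟩
        · exact ⟨i + 1, le_rfl, hk⟩
  obtain ⟨S, hS, -⟩ := this p.length le_rfl
  exact ⟨S, by simpa using hS⟩

theorem IsProper.exists_walk (hQ : Q.IsProper) {u v : Vertex Q.poly}
    (h : Q.NewVisits u.1 l S v.1) :
    ∃ p : (graph Q.poly).Walk u v, p.IsPath ∧ NonRevisiting p := by
  suffices H : ∀ y, Q.NewVisits u.1 l S y → ∀ v : Vertex Q.poly, v.1 = y →
      ∃ p : (graph Q.poly).Walk u v, p.IsPath ∧ NonRevisiting p ∧
        ∀ j ≤ p.length, Q.tight (p.getVert j).1 ⊆ S by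
    obtain ⟨p, h1, h2, -⟩ := H _ h v rfl
    exact ⟨p, h1, h2⟩
  clear h
  intro y h
  induction h with
  | refl =>
    intro v hv
    obtain rfl : v = u := Subtype.ext hv
    exact ⟨.nil, .nil, fun i hi => by simp at hi, fun j _ => by simp⟩
  | @step l S x y hx hy hxy hnew ih =>
    rintro v rfl
    let x' : Vertex Q.poly := ⟨x, isFace_zero_iff.2 (hx.visits.isVert (isVert_vertex u))⟩
    obtain ⟨p, hp, hnr, hS⟩ := ih x' rfl
    obtain ⟨k, hk, hkS⟩ := not_subset.1 hnew
    have hadj : (graph Q.poly).Adj x' v := graph_adj_iff.2 hxy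
    have hget : ∀ j ≤ p.length, (p.concat hadj).getVert j = p.getVert j := fun j hj => by
      rw [SimpleGraph.Walk.concat_eq_append, SimpleGraph.Walk.getVert_append]
      split_ifs with h
      · rfl
      · obtain rfl : j = p.length := by omega
        simp
    have hlast : (p.concat hadj).getVert (p.length + 1) = v := by
      rw [← SimpleGraph.Walk.length_concat p hadj, SimpleGraph.Walk.getVert_length]
    have hkE : k ∉ Q.E := fun h => hkS <|
      hx.visits.tight_start_subset (E_subset_tight (isVert_vertex u).1 h)
    refine ⟨p.concat hadj, hp.concat (fun hv => ?_) hadj, fun i hi => ?_, fun j hj => ?_⟩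
    · obtain ⟨j, hj, hjl⟩ := SimpleGraph.Walk.mem_support_iff_exists_getVert.1 hv
      exact hkS (hS j hjl (hj ▸ hk))
    · rw [SimpleGraph.Walk.length_concat] at hi
      rcases Nat.lt_succ_iff_lt_or_eq.1 hi with hi | rfl
      · obtain ⟨F, hF, h1, h2⟩ := hnr i hi
        refine ⟨F, hF, by rwa [hget _ (by omega)], fun j hj => ?_⟩
        rw [hget _ (by omega)]
        exact h2 j hj
      · refine ⟨Q.facetOf k, hQ.mem_facets.2 ⟨k, hkE, ⟨v.1, hy.1, hk⟩, rfl⟩, ?_, fun j hj h => ?_⟩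
        · rw [hlast]; exact ⟨hy.1, hk⟩
        · rw [hget j hj] at h
          exact hkS (hS j hj h.2)
    · rw [SimpleGraph.Walk.length_concat] at hj
      rcases Nat.le_succ_iff.1 hj with hj | rfl
      · rw [hget j hj]; exact (hS j hj).trans subset_union_left
      · rw [hlast]; exact subset_union_right

end Walks

end IneqSystem

/-! ### Wedges -/

namespace IneqSystem

section Wedge

variable {V W : Type*} [NormedAddCommGroup V] [NormedSpace ℝ V] [FiniteDimensional ℝ V]
  [NormedAddCommGroup W] [NormedSpace ℝ W] [FiniteDimensional ℝ W]
  {ι : Type*} [Fintype ι] [DecidableEq ι] (Q : IneqSystem V ι) (k : ι) (e : W ≃L[ℝ] V × ℝ)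

/-- The wedge over the constraint `k`, in coordinates `(x, t)` given by `e`: the points with `x` in
the original solution set and `0 ≤ t ≤ b k - a k x`. The constraint `none` is the bottom `0 ≤ t`,
and `some k` the top, which replaces the constraint `k`. -/
def wedge : IneqSystem W (Option ι) where
  a
    | none => -(ContinuousLinearMap.snd ℝ V ℝ ∘L (e : W →L[ℝ] V × ℝ))
    | some i => ((Q.a i ∘L ContinuousLinearMap.fst ℝ V ℝ) +
        if i = k then ContinuousLinearMap.snd ℝ V ℝ else 0) ∘L (e : W →L[ℝ] V × ℝ)
  b
    | none => 0
    | some i => Q.b i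
  E := Q.E.map Function.Embedding.some

variable {Q k e}

@[simp] theorem wedge_a_none (w : W) : (Q.wedge k e).a none w = -(e w).2 := rfl

theorem wedge_a_some {i : ι} (hi : i ≠ k) (w : W) :
    (Q.wedge k e).a (some i) w = Q.a i (e w).1 := by
  simp [wedge, hi]

@[simp] theorem wedge_a_self (w : W) :
    (Q.wedge k e).a (some k) w = Q.a k (e w).1 + (e w).2 := by
  simp [wedge]

@[simp] theorem wedge_b_none : (Q.wedge k e).b none = 0 := rfl
@[simp] theorem wedge_b_some (i : ι) : (Q.wedge k e).b (some i) = Q.b i := rfl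

@[simp] theorem some_mem_wedge_E {i : ι} : some i ∈ (Q.wedge k e).E ↔ i ∈ Q.E := by
  simp [wedge]

@[simp] theorem none_notMem_wedge_E : none ∉ (Q.wedge k e).E := by
  simp [wedge]

theorem none_mem_tight {w : W} : none ∈ (Q.wedge k e).tight w ↔ (e w).2 = 0 := by simp

theorem self_mem_tight {w : W} :
    some k ∈ (Q.wedge k e).tight w ↔ Q.a k (e w).1 + (e w).2 = Q.b k := by simp

theorem some_mem_tight {i : ι} (hi : i ≠ k) {w : W} :
    some i ∈ (Q.wedge k e).tight w ↔ i ∈ Q.tight (e w).1 := by simp [wedge_a_some hi]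

variable (hk : k ∉ Q.E)
include hk

theorem mem_wedge_poly {w : W} : w ∈ (Q.wedge k e).poly ↔
    (e w).1 ∈ Q.poly ∧ 0 ≤ (e w).2 ∧ Q.a k (e w).1 + (e w).2 ≤ Q.b k := by
  have hne : ∀ i ∈ Q.E, i ≠ k := fun i hi h => hk (h ▸ hi)
  constructor
  · rintro ⟨h1, h2⟩
    have h3 := h1 none
    have h4 := h1 (some k)
    simp only [wedge_a_none, wedge_b_none, wedge_a_self, wedge_b_some] at h3 h4
    refine ⟨⟨fun i => ?_, fun i hi => ?_⟩, by linarith, h4⟩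
    · by_cases hi : i = k
      · rw [hi]; linarith
      · have := h1 (some i)
        rwa [wedge_a_some hi] at this
    · have := h2 (some i) (some_mem_wedge_E.2 hi)
      rwa [wedge_a_some (hne i hi)] at this
  · rintro ⟨⟨h1, h2⟩, h3, h4⟩
    refine ⟨fun i => ?_, fun i hi => ?_⟩
    · rcases i with _ | i
      · simpa using h3
      · by_cases hi : i = k
        · rw [hi]; simpa using h4
        · rw [wedge_a_some hi]; exact h1 i
    · rcases i with _ | i
      · simp at hi
      · have hi := some_mem_wedge_E.1 hi
        rw [wedge_a_some (hne i hi)]; exact h2 i hi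

omit hk in
theorem mem_tight_fst_iff {w : W} (h0 : none ∈ (Q.wedge k e).tight w) :
    k ∈ Q.tight (e w).1 ↔ some k ∈ (Q.wedge k e).tight w := by
  rw [self_mem_tight, none_mem_tight.1 h0, add_zero, mem_tight]

/-- Over the facet `k`, the bottom and the top of the wedge meet. -/
theorem none_mem_tight_of_mem {w : W} (hw : w ∈ (Q.wedge k e).poly) (h : k ∈ Q.tight (e w).1) :
    none ∈ (Q.wedge k e).tight w ∧ some k ∈ (Q.wedge k e).tight w := by
  obtain ⟨-, h1, h2⟩ := (mem_wedge_poly hk).1 hw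
  rw [mem_tight] at h
  have : (e w).2 = 0 := by linarith
  rw [none_mem_tight, self_mem_tight, this, h, add_zero]
  exact ⟨rfl, rfl⟩

theorem wedge_isBounded (hb : Bornology.IsBounded Q.poly) :
    Bornology.IsBounded (Q.wedge k e).poly := by
  have h1 : Bornology.IsBounded (Q.a k '' Q.poly) := (Q.a k).lipschitz.isBounded_image hb
  obtain ⟨M, hM⟩ := h1.bddBelow
  have h2 : Bornology.IsBounded (e.symm '' (Q.poly ×ˢ Set.Icc 0 (Q.b k - M))) :=
    (e.symm : V × ℝ →L[ℝ] W).lipschitz.isBounded_image (hb.prod (Metric.isBounded_Icc _ _))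
  refine h2.subset fun w hw => ?_
  obtain ⟨h3, h4, h5⟩ := (mem_wedge_poly hk).1 hw
  have := hM ⟨_, h3, rfl⟩
  exact ⟨e w, ⟨h3, h4, by linarith⟩, by simp⟩

theorem wedge_isNondegenerate (hQ : Q.IsNondegenerate) : (Q.wedge k e).IsNondegenerate := by
  intro w hw i hi hiE
  have hP := (mem_wedge_poly hk).1 hw
  have hk0 := none_mem_tight_of_mem hk hw
  -- the requirements on a direction, in the coordinates of `V × ℝ`
  suffices H : ∃ (x : V) (t : ℝ), (Q.wedge k e).a i (e.symm (x, t)) < 0 ∧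
      (none ∈ (Q.wedge k e).tight w → none ≠ i → t = 0) ∧
      (some k ∈ (Q.wedge k e).tight w → some k ≠ i → Q.a k x + t = 0) ∧
      ∀ j ∈ Q.tight (e w).1, j ≠ k → some j ≠ i → Q.a j x = 0 by
    obtain ⟨x, t, h1, h2, h3, h4⟩ := H
    refine ⟨_, h1, fun j hj hji => ?_⟩
    rcases j with _ | j
    · simpa using h2 hj hji
    · by_cases hjk : j = k
      · subst hjk
        simpa using h3 hj hji
      · simpa [wedge_a_some hjk] using h4 j ((some_mem_tight hjk).1 hj) hjk hji
  rcases i with _ | i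
  · by_cases hkt : k ∈ Q.tight (e w).1
    · obtain ⟨x, hx, hx'⟩ := hQ _ hP.1 k hkt hk
      exact ⟨x, -Q.a k x, by simpa using hx, by simp, by simp, fun j hj hjk _ => hx' j hj hjk⟩
    · refine ⟨0, 1, by simp, by simp, fun h => (hkt ((mem_tight_fst_iff hi).2 h)).elim, by simp⟩
  · by_cases hik : i = k
    · subst hik
      by_cases h0 : none ∈ (Q.wedge i e).tight w
      · obtain ⟨x, hx, hx'⟩ := hQ _ hP.1 i ((mem_tight_fst_iff h0).2 hi) hk
        exact ⟨x, 0, by simpa using hx, by simp, by simp, fun j hj hjk _ => hx' j hj hjk⟩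
      · exact ⟨0, -1, by simp, fun h => (h0 h).elim, by simp, by simp⟩
    · obtain ⟨x, hx, hx'⟩ := hQ _ hP.1 i ((some_mem_tight hik).1 hi)
        fun h => hiE (some_mem_wedge_E.2 h)
      have h4 : ∀ j ∈ Q.tight (e w).1, j ≠ k → some j ≠ some i → Q.a j x = 0 :=
        fun j hj _ hji => hx' j hj fun h => hji (congrArg _ h)
      by_cases h0 : none ∈ (Q.wedge k e).tight w
      · exact ⟨x, 0, by simpa [wedge_a_some hik] using hx, by simp, fun h _ => by
          simpa using hx' k ((mem_tight_fst_iff h0).2 h) (Ne.symm hik), h4⟩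
      · exact ⟨x, -Q.a k x, by simpa [wedge_a_some hik] using hx, fun h => (h0 h).elim,
          by simp, h4⟩

/-- Vectors in a kernel of the original system lift to the wedge, horizontally if the bottom is
among the given constraints, and parallel to the top otherwise. -/
theorem exists_lift {S : Finset ι} {T : Finset (Option ι)} (hST : ∀ i ≠ k, some i ∈ T → i ∈ S)
    (hT : none ∈ T → some k ∈ T → k ∈ S) :
    ∃ f : Q.ker S →ₗ[ℝ] (Q.wedge k e).ker T, ∀ v, (e (f v).1).1 = v.1 := by
  by_cases h0 : none ∈ T
  · refine ⟨LinearMap.codRestrict _ ((e.symm : V × ℝ →L[ℝ] W).toLinearMap ∘ₗ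
      LinearMap.inl ℝ V ℝ ∘ₗ (Q.ker S).subtype) fun v i hi => ?_, fun v => by simp⟩
    rcases i with _ | i
    · simp
    · by_cases hik : i = k
      · subst hik; simpa using v.2 i (hT h0 hi)
      · simpa [wedge_a_some hik] using v.2 i (hST i hik hi)
  · refine ⟨LinearMap.codRestrict _ ((e.symm : V × ℝ →L[ℝ] W).toLinearMap ∘ₗ
      (LinearMap.id.prod (-(Q.a k).toLinearMap)) ∘ₗ (Q.ker S).subtype) fun v i hi => ?_,
      fun v => by simp⟩
    rcases i with _ | i
    · exact (h0 hi).elim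
    · by_cases hik : i = k
      · subst hik; simp
      · simpa [wedge_a_some hik] using v.2 i (hST i hik hi)

theorem finrank_ker_le_wedge {S : Finset ι} {T : Finset (Option ι)}
    (hST : ∀ i ≠ k, some i ∈ T → i ∈ S) (hT : none ∈ T → some k ∈ T → k ∈ S) :
    finrank ℝ (Q.ker S) ≤ finrank ℝ ((Q.wedge k e).ker T) := by
  obtain ⟨f, hf⟩ := exists_lift (e := e) hk hST hT
  refine LinearMap.finrank_le_finrank_of_injective (f := f) fun v v' h => Subtype.ext ?_
  rw [← hf, ← hf, h]

omit hk in
/-- A vertical direction stays on all constraints other than the bottom and the top. -/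
theorem vertical_mem_ker {T : Finset (Option ι)} (h0 : none ∉ T) (h1 : some k ∉ T) :
    e.symm (0, 1) ∈ (Q.wedge k e).ker T := by
  intro i hi
  rcases i with _ | i
  · exact (h0 hi).elim
  · have hik : i ≠ k := fun h => h1 (h ▸ hi)
    simp [wedge_a_some hik]

theorem IsVert.of_wedge {w : W} (hw : (Q.wedge k e).IsVert w) : Q.IsVert (e w).1 := by
  refine ⟨((mem_wedge_poly hk).1 hw.1).1, Submodule.finrank_eq_zero.1 ?_⟩
  have h := finrank_ker_le_wedge (e := e) (S := Q.tight (e w).1) (T := (Q.wedge k e).tight w) hk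
    (fun i hi h => (some_mem_tight hi).1 h) fun h0 h => (mem_tight_fst_iff h0).2 h
  rw [hw.2, finrank_bot] at h
  omega

theorem isVert_wedge {x : V} (hx : Q.IsVert x) (hxk : k ∉ Q.tight x) {t : ℝ}
    (ht : t = 0 ∨ t = Q.b k - Q.a k x) : (Q.wedge k e).IsVert (e.symm (x, t)) := by
  have hlt := lt_of_notMem_tight hx.1 hxk
  refine ⟨(mem_wedge_poly hk).2 ?_, (Submodule.eq_bot_iff _).2 fun w hw => ?_⟩
  · simp only [ContinuousLinearEquiv.apply_symm_apply]
    refine ⟨hx.1, ?_⟩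
    rcases ht with rfl | rfl <;> constructor <;> linarith
  · have h1 : (e w).1 ∈ Q.ker (Q.tight x) := fun i hi => by
      have hik : i ≠ k := fun h => hxk (h ▸ hi)
      rw [← wedge_a_some (Q := Q) (e := e) hik]
      exact hw (some i) ((some_mem_tight hik).2 (by simpa using hi))
    rw [hx.2, Submodule.mem_bot] at h1
    have h2 : (e w).2 = 0 := by
      rcases ht with rfl | rfl
      · simpa using hw none (by simp)
      · have := hw (some k) (by simp)
        simpa [h1] using this
    have : e w = 0 := Prod.ext h1 h2
    simpa using this

/-- An edge of the wedge that is not vertical projects to an edge, and lies on the bottom or on the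
top. -/
theorem Adj.of_wedge {w w' : W} (h : (Q.wedge k e).Adj w w') (hne : (e w).1 ≠ (e w').1) :
    Q.Adj (e w).1 (e w').1 ∧ (none ∈ (Q.wedge k e).tight w ∩ (Q.wedge k e).tight w' ∨
      some k ∈ (Q.wedge k e).tight w ∩ (Q.wedge k e).tight w') := by
  constructor
  · refine ⟨hne, (finrank_ker_le_wedge hk ?_ ?_).trans h.2⟩
    · intro i hi h
      rw [mem_inter] at h ⊢
      exact ⟨(some_mem_tight hi).1 h.1, (some_mem_tight hi).1 h.2⟩
    · intro h0 h
      rw [mem_inter] at h h0 ⊢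
      exact ⟨(mem_tight_fst_iff h0.1).2 h.1, (mem_tight_fst_iff h0.2).2 h.2⟩
  · by_contra! hcon
    have h1 := vertical_mem_ker (Q := Q) (e := e) hcon.1 hcon.2
    have h2 := (Q.wedge k e).sub_mem_ker (x := w) (y := w')
      (inter_subset_left (s₂ := (Q.wedge k e).tight w')) inter_subset_right
    have h3 := finrank_eq_one_of_ne h.1 inter_subset_left inter_subset_right h.2
    obtain ⟨c, hc⟩ := (finrank_eq_one_iff_of_nonzero' (⟨_, h1⟩ : (Q.wedge k e).ker _)
      (fun h => by simpa using congrArg Subtype.val h)).1 h3 ⟨_, h2⟩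
    have h4 := congrArg e (congrArg Subtype.val hc)
    simp only [Submodule.coe_smul, map_smul, ContinuousLinearEquiv.apply_symm_apply, map_sub] at h4
    have h5 := congrArg Prod.fst h4
    simp only [Prod.smul_fst, smul_zero, Prod.fst_sub] at h5
    exact hne (sub_eq_zero.1 h5.symm)

/-- A non-revisiting walk in the wedge that starts on the bottom projects to a non-revisiting walk.
The new constraint of a step is never the bottom. If it is the top, then the step is vertical and
disappears, or it runs along the bottom and enters the facet `k`. -/
theorem NewVisits.of_wedge {u w : W} (hu : (Q.wedge k e).IsVert u)
    (hu0 : none ∈ (Q.wedge k e).tight u) {l : ℕ} {T : Finset (Option ι)}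
    (h : (Q.wedge k e).NewVisits u l T w) :
    ∃ l' S, Q.NewVisits (e u).1 l' S (e w).1 ∧ (∀ i ≠ k, i ∈ S ↔ some i ∈ T) ∧
      (k ∈ S → some k ∈ T) := by
  induction h with
  | refl => exact ⟨0, _, .refl, fun i hi => (some_mem_tight hi).symm,
      fun h => (mem_tight_fst_iff hu0).1 h⟩
  | @step l T w w' hw hw' hadj hnew ih =>
    obtain ⟨l', S, hS, h1, h2⟩ := ih
    by_cases hpr : (e w).1 = (e w').1
    · refine ⟨l', S, hpr ▸ hS, fun i hi => ?_, fun h => mem_union_left _ (h2 h)⟩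
      rw [mem_union, h1 i hi, or_iff_left_of_imp]
      rw [some_mem_tight hi, ← hpr, ← h1 i hi]
      exact fun h => hS.visits.tight_subset h
    · obtain ⟨hadj', hcom⟩ := Adj.of_wedge hk hadj hpr
      refine ⟨l' + 1, S ∪ Q.tight (e w').1, .step hS (IsVert.of_wedge hk hw') hadj' ?_,
        fun i hi => ?_, fun h => ?_⟩
      · obtain ⟨j, hj, hjT⟩ := not_subset.1 hnew
        rcases j with _ | j
        · exact (hjT (hw.visits.tight_start_subset hu0)).elim
        · by_cases hjk : j = k
          · subst hjk
            have h0 : none ∈ (Q.wedge j e).tight w' := by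
              rcases hcom with h | h
              · exact (mem_inter.1 h).2
              · exact (hjT (hw.visits.tight_subset (mem_inter.1 h).1)).elim
            exact fun hsub => hjT (h2 (hsub ((mem_tight_fst_iff h0).2 hj)))
          · exact fun hsub => hjT ((h1 j hjk).1 (hsub ((some_mem_tight hjk).1 hj)))
      · rw [mem_union, mem_union, h1 i hi, some_mem_tight hi]
      · rcases mem_union.1 h with h | h
        · exact mem_union_left _ (h2 h)
        · exact mem_union_right _ (none_mem_tight_of_mem hk hw'.1 h).2

end Wedge

end IneqSystem

/-! ### From the Hirsch conjecture to the `d`-step conjecture, and on to non-revisiting paths -/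

namespace IneqSystem

section Restrict

variable {V : Type*} [NormedAddCommGroup V] [NormedSpace ℝ V] [FiniteDimensional ℝ V]
  {ι : Type*} [Fintype ι] [DecidableEq ι] {Q : IneqSystem V ι}

variable (Q) in
/-- The same constraints, with `T` as the set of equations. For `Q.E ⊆ T` this describes a face. -/
def restrict (T : Finset ι) : IneqSystem V ι := ⟨Q.a, Q.b, T⟩

theorem mem_restrict {T : Finset ι} (hT : Q.E ⊆ T) {x : V} :
    x ∈ (Q.restrict T).poly ↔ x ∈ Q.poly ∧ T ⊆ Q.tight x :=
  ⟨fun h => ⟨⟨h.1, fun _ hi => h.2 _ (hT hi)⟩, fun _ hi => mem_tight.2 (h.2 _ hi)⟩,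
    fun h => ⟨h.1.1, fun _ hi => mem_tight.1 (h.2 hi)⟩⟩

theorem isVert_restrict {T : Finset ι} (hT : Q.E ⊆ T) {x : V} :
    (Q.restrict T).IsVert x ↔ Q.IsVert x ∧ T ⊆ Q.tight x := by
  rw [IsVert, mem_restrict hT, and_right_comm]
  rfl

theorem IsNondegenerate.restrict (hQ : Q.IsNondegenerate) {T : Finset ι} (hT : Q.E ⊆ T) :
    (Q.restrict T).IsNondegenerate := fun x hx i hi hiT =>
  hQ x ((mem_restrict hT).1 hx).1 i hi fun h => hiT (hT h)

theorem NewVisits.of_restrict {T : Finset ι} (hT : Q.E ⊆ T) {u y : V} {l : ℕ} {S : Finset ι}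
    (h : (Q.restrict T).NewVisits u l S y) : Q.NewVisits u l S y := by
  induction h with
  | refl => exact .refl
  | step _ hy hxy hnew ih => exact .step ih ((isVert_restrict hT).1 hy).1 hxy hnew

variable (hQ : Q.IsNondegenerate)
include hQ

/-- Between complementary vertices, a walk has to visit all the facets at its end as new ones. -/
theorem IsNondegenerate.card_add_le {u v : V} (hv : Q.IsVert v)
    (huv : Q.tight u ∩ Q.tight v = Q.E) {l : ℕ} {S : Finset ι} (hS : Q.Visits u l S v) :
    #(Q.tight u) + finrank ℝ (Q.ker Q.E) ≤ #S := by
  rw [← hQ.card_of_isVert hv, ← huv, inter_comm, sdiff_inter_self_left,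
    ← card_union_of_disjoint disjoint_sdiff, union_sdiff_self_eq_union]
  exact card_le_card (union_subset hS.tight_start_subset hS.tight_subset)

theorem IsNondegenerate.finrank_le_length {u v : Vertex Q.poly}
    (p : (graph Q.poly).Walk u v) (huv : Q.tight u.1 ∩ Q.tight v.1 = Q.E) :
    finrank ℝ (Q.ker Q.E) ≤ p.length := by
  obtain ⟨S, hS⟩ := exists_visits p
  have h1 := (hQ.card_le (isVert_vertex u) hS).1
  have h2 := hQ.card_add_le (isVert_vertex v) huv hS
  omega

theorem IsNondegenerate.exists_newVisits_of_walk {u v : Vertex Q.poly}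
    (p : (graph Q.poly).Walk u v) (hp : p.length = finrank ℝ (Q.ker Q.E))
    (huv : Q.tight u.1 ∩ Q.tight v.1 = Q.E) : ∃ l S, Q.NewVisits u.1 l S v.1 := by
  obtain ⟨S, hS⟩ := exists_visits p
  obtain ⟨h1, h2⟩ := hQ.card_le (isVert_vertex u) hS
  exact ⟨_, S, h2 (le_antisymm h1 (hp ▸ hQ.card_add_le (isVert_vertex v) huv hS))⟩

end Restrict

end IneqSystem

open IneqSystem

/-- The induction on the number of constraints tight at neither of the two vertices. The ambient
dimension and the index type are quantified inside, since both grow with each wedge. -/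
theorem exists_newVisits_of_dStep (hD : DStepConjecture) (N : ℕ) :
    ∀ (ι : Type) [Fintype ι] [DecidableEq ι] (m : ℕ)
      (Q : IneqSystem (EuclideanSpace ℝ (Fin m)) ι), Bornology.IsBounded Q.poly →
      Q.IsNondegenerate → ∀ u v, Q.IsVert u → Q.IsVert v → #(Q.tight u ∪ Q.tight v)ᶜ = N →
      ∃ l S, Q.NewVisits u l S v := by
  induction N with
  | zero =>
    intro ι _ _ m Q hb hQ u v hu hv hN
    rw [card_eq_zero, compl_eq_empty_iff] at hN
    have hE : Q.E ⊆ Q.tight u ∩ Q.tight v :=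
      subset_inter (E_subset_tight hu.1) (E_subset_tight hv.1)
    -- pass to the smallest face containing `u` and `v`
    let R := Q.restrict (Q.tight u ∩ Q.tight v)
    have hR : R.IsNondegenerate := hQ.restrict hE
    have hu' : R.IsVert u := (isVert_restrict hE).2 ⟨hu, inter_subset_left⟩
    have hv' : R.IsVert v := (isVert_restrict hE).2 ⟨hv, inter_subset_right⟩
    have hRb : Bornology.IsBounded R.poly := hb.subset fun x hx => ((mem_restrict hE).1 hx).1
    have hprop := hR.isProper ⟨u, hu'.1⟩
    have hne : ∀ i ∉ R.E, (R.facetOf i).Nonempty := fun i _ => by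
      have : i ∈ Q.tight u ∪ Q.tight v := hN ▸ mem_univ i
      rcases mem_union.1 this with h | h
      · exact ⟨u, hu'.1, h⟩
      · exact ⟨v, hv'.1, h⟩
    have hcard : #(R.Eᶜ) = 2 * finrank ℝ (R.ker R.E) := by
      have h1 : R.Eᶜ = (R.tight u \ R.E) ∪ (R.tight v \ R.E) := by
        rw [← union_sdiff_distrib]
        exact (congrArg (· \ R.E) hN).symm
      have h2 : Disjoint (R.tight u \ R.E) (R.tight v \ R.E) :=
        disjoint_left.2 fun i hi hi' => (Finset.mem_sdiff.1 hi).2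
          (mem_inter.2 ⟨(Finset.mem_sdiff.1 hi).1, (Finset.mem_sdiff.1 hi').1⟩)
      rw [h1, card_union_of_disjoint h2, hR.card_of_isVert hu', hR.card_of_isVert hv', two_mul]
    obtain ⟨p, -, hp⟩ := hD _ m R.poly (hprop.isPolytope hRb) (hR.isSimple ⟨u, hu'.1⟩)
      (by rw [hprop.encard_facets hne, hcard]) ⟨u, isFace_zero_iff.2 hu'⟩
      ⟨v, isFace_zero_iff.2 hv'⟩ fun F hF hmem => by
        obtain ⟨i, hi, -, rfl⟩ := hprop.mem_facets.1 hF
        exact hi (mem_inter.2 ⟨hmem.1.2, hmem.2.2⟩)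
    obtain ⟨l, S, h⟩ := hR.exists_newVisits_of_walk p hp rfl
    exact ⟨l, S, h.of_restrict hE⟩
  | succ N ih =>
    intro ι _ _ m Q hb hQ u v hu hv hN
    obtain ⟨k, hk⟩ : (Q.tight u ∪ Q.tight v)ᶜ.Nonempty := card_pos.1 (by omega)
    obtain ⟨hku, hkv⟩ : k ∉ Q.tight u ∧ k ∉ Q.tight v := by simpa using hk
    have hkE : k ∉ Q.E := fun h => hku (E_subset_tight hu.1 h)
    let e : EuclideanSpace ℝ (Fin (m + 1)) ≃L[ℝ] EuclideanSpace ℝ (Fin m) × ℝ :=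
      ContinuousLinearEquiv.ofFinrankEq (by simp)
    let u' := e.symm (u, 0)
    let v' := e.symm (v, Q.b k - Q.a k v)
    have hu' : (Q.wedge k e).IsVert u' := isVert_wedge hkE hu hku (Or.inl rfl)
    have hv' : (Q.wedge k e).IsVert v' := isVert_wedge hkE hv hkv (Or.inr rfl)
    have hu0 : none ∈ (Q.wedge k e).tight u' := by simp [u']
    have hvk : some k ∈ (Q.wedge k e).tight v' := by simp [v']
    obtain ⟨l, T, h⟩ := ih (Option ι) (m + 1) (Q.wedge k e) (wedge_isBounded hkE hb)
      (wedge_isNondegenerate hkE hQ) u' v' hu' hv' (by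
        have : ((Q.wedge k e).tight u' ∪ (Q.wedge k e).tight v')ᶜ =
            (((Q.tight u ∪ Q.tight v)ᶜ).erase k).map Function.Embedding.some := by
          ext i
          rcases i with _ | i
          · simpa using fun h => (h (by simpa using hu0)).elim
          · by_cases hik : i = k
            · subst hik
              simpa using fun _ => by simpa using hvk
            · simp [hik, wedge_a_some hik, u', v']
        rw [this, card_map, card_erase_of_mem hk, hN, Nat.add_sub_cancel])
    obtain ⟨l', S, hS, -⟩ := NewVisits.of_wedge hkE hu' hu0 h
    exact ⟨l', S, by simpa [u', v'] using hS⟩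

theorem nonRevisitingConjecture_of_dStepConjecture (hD : DStepConjecture) :
    NonRevisitingConjecture := by
  intro d m P hP hs u v
  obtain ⟨s, _, Q, rfl, hQ, -, -⟩ := exists_of_isPolytope hP
  obtain ⟨l, S, h⟩ := exists_newVisits_of_dStep hD _ s m Q hP.isBounded
    (hQ.isNondegenerate hP.isBounded hs) u.1 v.1 (isVert_vertex u) (isVert_vertex v) rfl
  exact hQ.exists_walk h

theorem dStepConjecture_of_hirschConjecture (hH : HirschConjecture) : DStepConjecture := by
  intro d m P hP hs hn u v huv
  obtain ⟨s, _, Q, rfl, hQ, -, hd⟩ := exists_of_isPolytope hP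
  have hND := hQ.isNondegenerate hP.isBounded hs
  have hE : Q.tight u.1 ∩ Q.tight v.1 = Q.E := by
    refine Subset.antisymm (fun i hi => ?_) (subset_inter (E_subset_tight (isVert_vertex u).1)
      (E_subset_tight (isVert_vertex v).1))
    by_contra hiE
    obtain ⟨hi1, hi2⟩ := mem_inter.1 hi
    exact huv (Q.facetOf i) (hQ.mem_facets.2 ⟨i, hiE, ⟨u.1, (isVert_vertex u).1, hi1⟩, rfl⟩)
      ⟨⟨(isVert_vertex u).1, hi1⟩, (isVert_vertex v).1, hi2⟩
  -- every walk from `u` to `v` has length at least `d`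
  suffices H : ∃ p : (graph Q.poly).Walk u v, p.length ≤ d by
    classical
    obtain ⟨p, hp⟩ := H
    have hp' : p.bypass.length ≤ d := p.length_bypass_le_length.trans hp
    refine ⟨p.bypass, p.bypass_isPath, le_antisymm hp' ?_⟩
    rw [← hd]
    exact hND.finrank_le_length p.bypass hE
  -- the bound of the Hirsch conjecture is only available for `2 ≤ d`
  obtain hd2 | rfl | rfl : 2 ≤ d ∨ d = 0 ∨ d = 1 := by omega
  · have h1 := hH (2 * d) d m _ hd2 (by omega) hP hn
    have h2 : (graph Q.poly).edist u v ≤ d := by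
      refine SimpleGraph.edist_le_ediam.trans (h1.trans ?_)
      rw [two_mul, Nat.add_sub_cancel]
    obtain ⟨p, hp⟩ := SimpleGraph.exists_walk_of_edist_ne_top (ne_top_of_le_ne_top (by simp) h2)
    exact ⟨p, by rw [← hp] at h2; exact_mod_cast h2⟩
  · have := Q.sub_mem_ker (E_subset_tight (isVert_vertex u).1) (E_subset_tight (isVert_vertex v).1)
    rw [Submodule.finrank_eq_zero.1 hd, Submodule.mem_bot, sub_eq_zero] at this
    obtain rfl : u = v := Subtype.ext this
    exact ⟨.nil, by simp⟩
  · by_cases h : u = v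
    · subst h
      exact ⟨.nil, by simp⟩
    · have hadj : (graph Q.poly).Adj u v := graph_adj_iff.2
        ⟨fun h' => h (Subtype.ext h'), by rw [hE]; exact hd.le⟩
      exact ⟨hadj.toWalk, by simp⟩

/-! ### Perturbation to a simple polytope -/

namespace IneqSystem

section Perturb

variable {V : Type*} [NormedAddCommGroup V] [NormedSpace ℝ V] [FiniteDimensional ℝ V]
  {ι : Type*} [Fintype ι] [DecidableEq ι] (Q : IneqSystem V ι)

/-- The amount by which the constraint `i` is relaxed: distinct positive powers of `ε` for distinct
inequalities, and nothing for equations. -/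
noncomputable def bump (i : ι) (ε : ℝ) : ℝ :=
  if i ∈ Q.E then 0 else ε ^ (Fintype.equivFin ι i + 1 : ℕ)

/-- The system with its inequalities relaxed by powers of `ε`. -/
noncomputable def perturb (ε : ℝ) : IneqSystem V ι := ⟨Q.a, fun i => Q.b i + Q.bump i ε, Q.E⟩

variable {Q}

theorem bump_zero (i : ι) : Q.bump i 0 = 0 := by simp [bump]

theorem bump_of_mem {i : ι} (hi : i ∈ Q.E) (ε : ℝ) : Q.bump i ε = 0 := by simp [bump, hi]

theorem bump_nonneg (i : ι) {ε : ℝ} (h : 0 ≤ ε) : 0 ≤ Q.bump i ε := by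
  unfold bump; split_ifs <;> positivity

theorem bump_le_one (i : ι) {ε : ℝ} (h : 0 ≤ ε) (h1 : ε ≤ 1) : Q.bump i ε ≤ 1 := by
  unfold bump
  split_ifs
  · exact zero_le_one
  · exact pow_le_one₀ h h1

theorem continuous_bump (i : ι) : Continuous (Q.bump i) := by
  unfold bump; split_ifs <;> fun_prop

theorem poly_subset_perturb {ε : ℝ} (h : 0 ≤ ε) : Q.poly ⊆ (Q.perturb ε).poly := fun x hx =>
  ⟨fun i => (hx.1 i).trans (le_add_of_nonneg_right (bump_nonneg i h)),
    fun i (hi : i ∈ Q.E) => by simp [perturb, bump_of_mem hi, hx.2 i hi]⟩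

theorem perturb_zero : Q.perturb 0 = Q := by simp [perturb, bump_zero]

/-- The perturbed solution sets stay in a fixed compact set, a dilation of the original solution set
about a relative interior point. -/
theorem exists_isCompact_perturb (hb : Bornology.IsBounded Q.poly) (hQ : Q.IsProper) :
    ∃ K : Set V, IsCompact K ∧ ∀ ε, 0 ≤ ε → ε ≤ 1 → (Q.perturb ε).poly ⊆ K := by
  obtain ⟨x, hx, hxE⟩ := hQ.interior
  have hc : ∀ i, 0 ≤ 1 / (Q.b i - Q.a i x) := fun i => by
    have := hx.1 i
    exact one_div_nonneg.2 (by linarith)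
  set c := 1 + ∑ i, 1 / (Q.b i - Q.a i x) with hcdef
  have hc1 : 1 ≤ c := le_add_of_nonneg_right (sum_nonneg fun i _ => hc i)
  refine ⟨(fun y => x + c • (y - x)) '' Q.poly,
    (Metric.isCompact_of_isClosed_isBounded Q.isClosed_poly hb).image (by fun_prop),
    fun ε h0 h1 y hy => ⟨x + c⁻¹ • (y - x), ⟨fun i => ?_, fun i hi => ?_⟩, ?_⟩⟩
  · by_cases hi : i ∈ Q.E
    · have h2 := hy.2 i hi
      simp only [perturb, bump_of_mem hi, add_zero] at h2
      simp [hx.2 i hi, h2]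
    · have hlt : Q.a i x < Q.b i := lt_of_notMem_tight hx (hxE ▸ hi)
      have hyi : Q.a i y ≤ Q.b i + Q.bump i ε := hy.1 i
      have hle := Q.bump_le_one i h0 h1
      have hs : 1 + 1 / (Q.b i - Q.a i x) ≤ c :=
        add_le_add_right (single_le_sum (f := fun i => 1 / (Q.b i - Q.a i x))
          (fun i _ => hc i) (mem_univ i)) 1
      have hpos : 0 < Q.b i - Q.a i x := by linarith
      have h3 : Q.a i y - Q.a i x ≤ c * (Q.b i - Q.a i x) := by
        have := mul_le_mul_of_nonneg_right hs hpos.le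
        rw [add_mul, one_div_mul_cancel hpos.ne'] at this
        linarith
      have h4 : c⁻¹ * (Q.a i y - Q.a i x) ≤ Q.b i - Q.a i x :=
        (inv_mul_le_iff₀ (by linarith)).2 h3
      simp only [map_add, map_smul, map_sub, smul_eq_mul]
      linarith
  · have h2 := hy.2 i hi
    simp only [perturb, bump_of_mem hi, add_zero] at h2
    simp [hx.2 i hi, h2]
  · have : c ≠ 0 := by linarith
    simp [smul_smul, this]

/-- For small `ε`, constraints that are simultaneously tight at a point of the perturbed solution set
with `γ ≤ c` are so at such a point of the original one: otherwise the `ε` where this fails would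
accumulate at `0`, and by compactness so would the points. -/
theorem eventually_perturb_feasible (hb : Bornology.IsBounded Q.poly) (hQ : Q.IsProper)
    (c : StrongDual ℝ V) (γ : ℝ) : ∀ᶠ ε in 𝓝[>] 0, ∀ (T : Finset ι), ∀ x ∈ (Q.perturb ε).poly,
      T ⊆ (Q.perturb ε).tight x → γ ≤ c x → ∃ y ∈ Q.poly, T ⊆ Q.tight y ∧ γ ≤ c y := by
  obtain ⟨K, hK, hKP⟩ := exists_isCompact_perturb hb hQ
  refine eventually_all.2 fun T => ?_
  by_cases hT : ∃ y ∈ Q.poly, T ⊆ Q.tight y ∧ γ ≤ c y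
  · exact Eventually.of_forall fun _ _ _ _ _ => hT
  let C : Set (ℝ × V) := (Set.Icc 0 1 ×ˢ K) ∩ ((⋂ i, {p | Q.a i p.2 ≤ Q.b i + Q.bump i p.1}) ∩
    (⋂ i ∈ Q.E ∪ T, {p | Q.a i p.2 = Q.b i + Q.bump i p.1}) ∩ {p | γ ≤ c p.2})
  have hbc : ∀ i, Continuous fun p : ℝ × V => Q.b i + Q.bump i p.1 := fun i =>
    continuous_const.add ((continuous_bump i).comp continuous_fst)
  have hac : ∀ i, Continuous fun p : ℝ × V => Q.a i p.2 := fun i => by fun_prop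
  have hC : IsCompact C := (isCompact_Icc.prod hK).inter_right <|
    ((isClosed_iInter fun i => isClosed_le (hac i) (hbc i)).inter
      (isClosed_biInter fun i _ => isClosed_eq (hac i) (hbc i))).inter
      (isClosed_le continuous_const (by fun_prop))
  have hmem : ∀ ε x, (ε, x) ∈ C ↔ (ε ∈ Set.Icc (0 : ℝ) 1 ∧ x ∈ K) ∧
      (x ∈ (Q.perturb ε).poly ∧ T ⊆ (Q.perturb ε).tight x) ∧ γ ≤ c x := fun ε x => by
    simp only [C, Set.mem_inter_iff, Set.mem_prod, Set.mem_iInter, Set.mem_ofPred_eq, mem_union,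
      or_imp, forall_and, poly, perturb, subset_iff, mem_tight]
    tauto
  have h0 : (0 : ℝ) ∉ Prod.fst '' C := by
    rintro ⟨⟨ε, x⟩, hx, rfl⟩
    obtain ⟨-, ⟨h1, h2⟩, h3⟩ := (hmem _ _).1 hx
    simp only [perturb_zero] at h1 h2
    exact hT ⟨x, h1, h2, h3⟩
  have h1 : ∀ᶠ ε in 𝓝[>] (0 : ℝ), ε ∉ Prod.fst '' C :=
    mem_nhdsWithin_of_mem_nhds ((hC.image continuous_fst).isClosed.isOpen_compl.mem_nhds h0)
  filter_upwards [h1, Ioc_mem_nhdsGT (zero_lt_one' ℝ)] with ε hε hε1 x hx hxT hγ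
  exact (hε ⟨(ε, x), (hmem _ _).2 ⟨⟨⟨hε1.1.le, hε1.2⟩, hKP ε hε1.1.le hε1.2 hx⟩, ⟨hx, hxT⟩, hγ⟩,
    rfl⟩).elim

/-- Either `a i` can be decreased while all of `T` stays fixed, or it is a combination of `T`. -/
theorem exists_direction_or_combination (T : Finset ι) (i : ι) :
    (∃ w, Q.a i w < 0 ∧ ∀ j ∈ T, Q.a j w = 0) ∨
      ∃ c : T → ℝ, ∀ x, Q.a i x = ∑ j, c j * Q.a j x := by
  by_cases h : ∃ w, Q.a i w ≠ 0 ∧ ∀ j ∈ T, Q.a j w = 0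
  · obtain ⟨w, hw, hw'⟩ := h
    rcases lt_or_gt_of_ne hw with h | h
    · exact .inl ⟨w, h, hw'⟩
    · exact .inl ⟨-w, by simpa using h, fun j hj => by simp [hw' j hj]⟩
  · right
    have := mem_span_of_iInf_ker_le_ker (L := fun j : T => (Q.a j).toLinearMap)
      (K := (Q.a i).toLinearMap) fun w hw => by
        by_contra hne
        exact h ⟨w, hne, fun j hj => by simpa using (Submodule.mem_iInf _).1 hw ⟨j, hj⟩⟩
    obtain ⟨c, hc⟩ := (Submodule.mem_span_range_iff_exists_fun ℝ).1 this
    exact ⟨c, fun x => by simpa using (LinearMap.congr_fun hc x).symm⟩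

open Polynomial in
/-- The powers of `ε` avoid, up to finitely many `ε`, all the equations that the right-hand sides
would have to satisfy at a point where dependent functionals are tight. -/
theorem eventually_isNondegenerate : ∀ᶠ ε in 𝓝[>] 0, (Q.perturb ε).IsNondegenerate := by
  have key : ∀ (T : Finset ι) (i : ι), ∀ᶠ ε in 𝓝[>] (0 : ℝ), i ∉ Q.E → i ∉ T →
      (∃ c : T → ℝ, ∀ x, Q.a i x = ∑ j, c j * Q.a j x) →
        ¬ ∃ x, Q.a i x = Q.b i + Q.bump i ε ∧ ∀ j ∈ T, Q.a j x = Q.b j + Q.bump j ε := by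
    intro T i
    by_cases h : i ∉ Q.E ∧ i ∉ T ∧ ∃ c : T → ℝ, ∀ x, Q.a i x = ∑ j, c j * Q.a j x
    swap
    · exact Eventually.of_forall fun ε h1 h2 hc => (h ⟨h1, h2, hc⟩).elim
    obtain ⟨hiE, hiT, c, hc⟩ := h
    let B : ι → ℝ[X] := fun j => C (Q.b j) +
      if j ∈ Q.E then 0 else X ^ (Fintype.equivFin ι j + 1 : ℕ)
    have hB : ∀ j ε, (B j).eval ε = Q.b j + Q.bump j ε := fun j ε => by
      simp only [B, bump]; split_ifs <;> simp
    have hcoeff : ∀ j, (B j).coeff (Fintype.equivFin ι i + 1 : ℕ) = if j = i then 1 else 0 := by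
      intro j
      by_cases hj : j ∈ Q.E
      · have : j ≠ i := fun h => hiE (h ▸ hj)
        simp [B, hj, this]
      · simp [B, hj, coeff_X_pow, Fin.val_inj, eq_comm]
    -- nonzero, as only `B i` contains the power of `X` belonging to `i`
    let p : ℝ[X] := B i - ∑ j, C (c j) * B j
    have hp : p ≠ 0 := fun h0 => by
      have h1 := congrArg (fun q : ℝ[X] => q.coeff (Fintype.equivFin ι i + 1 : ℕ)) h0
      have h2 : ∀ j : T, (j : ι) ≠ i := fun j h => hiT (h ▸ j.2)
      simp [p, hcoeff, h2] at h1
    have hfin : {ε | p.IsRoot ε}.Finite := Polynomial.finite_setOfPred_isRoot hp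
    have hev : ∀ᶠ ε in 𝓝[>] (0 : ℝ), ε ∉ {ε | p.IsRoot ε} := by
      refine mem_nhdsWithin.2 ⟨({ε | p.IsRoot ε} \ {0})ᶜ,
        (hfin.subset Set.sdiff_subset).isClosed.isOpen_compl, by simp, ?_⟩
      rintro ε ⟨h1, h2⟩ h3
      exact h1 ⟨h3, ne_of_gt h2⟩
    filter_upwards [hev] with ε hε _ _ _
    rintro ⟨x, hxi, hxT⟩
    refine hε ?_
    simp only [IsRoot.def, p, eval_sub, eval_finsetSum, eval_mul, eval_C, hB]
    rw [← hxi, hc, sub_eq_zero]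
    exact sum_congr rfl fun j _ => by rw [hxT j j.2]
  have h1 := eventually_all.2 fun T => eventually_all.2 fun i => key T i
  filter_upwards [h1] with ε hε x hx i hi hiE
  rcases Q.exists_direction_or_combination (((Q.perturb ε).tight x).erase i) i with h | ⟨c, hc⟩
  · obtain ⟨w, hw, hw'⟩ := h
    exact ⟨w, hw, fun j hj hji => hw' j (mem_erase.2 ⟨hji, hj⟩)⟩
  · exact (hε _ i hiE (notMem_erase _ _) ⟨c, hc⟩
      ⟨x, mem_tight.1 hi, fun j hj => mem_tight.1 (mem_of_mem_erase hj)⟩).elim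

/-- Walks in the perturbed polytope yield walks in the original one that are not longer: each perturbed
vertex is sent to the point where its tight constraints are tight in the original system. -/
theorem exists_walk_of_visits {ε : ℝ}
    (hε : ∀ (T : Finset ι), ∀ x ∈ (Q.perturb ε).poly, T ⊆ (Q.perturb ε).tight x →
      ∃ y ∈ Q.poly, T ⊆ Q.tight y)
    {u : Vertex Q.poly} {u' w' : V} (hu' : (Q.perturb ε).IsVert u')
    (hu : (Q.perturb ε).tight u' ⊆ Q.tight u.1) {l : ℕ} {S : Finset ι}
    (h : (Q.perturb ε).Visits u' l S w') :
    ∀ w : Vertex Q.poly, (Q.perturb ε).tight w' ⊆ Q.tight w.1 →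
      ∃ p : (graph Q.poly).Walk u w, p.length ≤ l := by
  induction h with
  | refl =>
    intro w hw
    have h1 : w.1 - u.1 ∈ (Q.perturb ε).ker ((Q.perturb ε).tight u') := sub_mem_ker (Q := Q) hw hu
    rw [hu'.2, Submodule.mem_bot, sub_eq_zero] at h1
    obtain rfl : w = u := Subtype.ext h1
    exact ⟨.nil, le_rfl⟩
  | @step l S x' w' hx' hw' hadj ih =>
    intro w hw
    have hx'' := hx'.isVert hu'
    obtain ⟨x, hx, hxt⟩ := hε _ x' hx''.1 subset_rfl
    have hxv : Q.IsVert x := ⟨hx, le_bot_iff.1 (hx''.2 ▸ Q.ker_anti hxt)⟩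
    obtain ⟨p, hp⟩ := ih ⟨x, isFace_zero_iff.2 hxv⟩ hxt
    by_cases hxw : x = w.1
    · obtain rfl : (⟨x, isFace_zero_iff.2 hxv⟩ : Vertex Q.poly) = w := Subtype.ext hxw
      exact ⟨p, by omega⟩
    · have : (graph Q.poly).Adj ⟨x, isFace_zero_iff.2 hxv⟩ w := graph_adj_iff.2 ⟨hxw,
        (Submodule.finrank_mono (Q.ker_anti (inter_subset_inter hxt hw))).trans hadj.2⟩
      exact ⟨p.concat this, by rw [SimpleGraph.Walk.length_concat]; omega⟩

/-- Every vertex `u` comes from a perturbed vertex, namely a maximizer of a functional that attains its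
maximum over the original polytope at `u` only. -/
theorem eventually_exists_isVert_perturb (hb : Bornology.IsBounded Q.poly) (hQ : Q.IsProper)
    {u : V} (hu : Q.IsVert u) : ∀ᶠ ε in 𝓝[>] 0, ∃ u', (Q.perturb ε).IsVert u' ∧
      (Q.perturb ε).tight u' ⊆ Q.tight u := by
  obtain ⟨K, hK, hKP⟩ := exists_isCompact_perturb hb hQ
  let c : StrongDual ℝ V := ∑ i ∈ Q.tight u, Q.a i
  have hc : ∀ x, c x = ∑ i ∈ Q.tight u, Q.a i x := fun x => _root_.sum_apply ..
  have hcu : c u = ∑ i ∈ Q.tight u, Q.b i := by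
    rw [hc]; exact sum_congr rfl fun i hi => mem_tight.1 hi
  filter_upwards [eventually_perturb_feasible hb hQ c (c u), Ioc_mem_nhdsGT (zero_lt_one' ℝ)]
    with ε hε h01
  have hsub := Q.poly_subset_perturb h01.1.le
  obtain ⟨u', hu', hmax⟩ := exists_isVert_isMax (hK.isBounded.subset (hKP ε h01.1.le h01.2))
    ⟨u, hsub hu.1⟩ c
  obtain ⟨y, hy, hyt, hyc⟩ := hε _ u' hu'.1 subset_rfl (hmax u (hsub hu.1))
  have hyu : Q.tight u ⊆ Q.tight y := fun i hi => by
    have h1 : c y = ∑ i ∈ Q.tight u, Q.b i :=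
      le_antisymm (by rw [hc]; exact sum_le_sum fun i _ => hy.1 i) (hcu ▸ hyc)
    rw [hc] at h1
    exact mem_tight.2 ((sum_eq_sum_iff_of_le fun i _ => hy.1 i).1 h1 i hi)
  obtain rfl := eq_of_ker_eq_bot hu.2 hyu
  exact ⟨u', hu', hyt⟩

end Perturb

end IneqSystem

open IneqSystem

theorem hirschConjecture_of_nonRevisitingConjecture (hN : NonRevisitingConjecture) :
    HirschConjecture := by
  intro n d m P _ _ hP hn
  obtain ⟨s, _, Q, rfl, hQ, hne, hd⟩ := exists_of_isPolytope hP
  have hb := hP.isBounded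
  rw [hQ.encard_facets hne] at hn
  have hn : #(Q.Eᶜ) = n := by exact_mod_cast hn
  refine SimpleGraph.ediam_le_of_edist_le fun u v => ?_
  obtain ⟨K, hK, hKP⟩ := exists_isCompact_perturb hb hQ
  obtain ⟨ε, ⟨⟨⟨hND, hε⟩, u', hu', hut⟩, v', hv', hvt⟩, h0, h1⟩ :=
    ((((Q.eventually_isNondegenerate.and (eventually_perturb_feasible hb hQ 0 0)).and
      (eventually_exists_isVert_perturb hb hQ (isVert_vertex u))).and
      (eventually_exists_isVert_perturb hb hQ (isVert_vertex v))).and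
      (Ioc_mem_nhdsGT (zero_lt_one' ℝ))).exists
  have hprop := hND.isProper ⟨u', hu'.1⟩
  obtain ⟨p, -, hp⟩ := hN _ m _ (hprop.isPolytope (hK.isBounded.subset (hKP ε h0.le h1)))
    (hND.isSimple ⟨u', hu'.1⟩) ⟨u', isFace_zero_iff.2 hu'⟩ ⟨v', isFace_zero_iff.2 hv'⟩
  obtain ⟨S, hS⟩ := hprop.exists_newVisits p hp
  obtain ⟨q, hq⟩ := exists_walk_of_visits (fun T x hx hT => by
    obtain ⟨y, hy, hyT, -⟩ := hε T x hx hT (by simp)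
    exact ⟨y, hy, hyT⟩) hu' hut hS.visits v hvt
  have h2 : #((Q.perturb ε).tight u') + p.length ≤ #S := hS.card_le
  have h3 : #((Q.perturb ε).tight u' \ Q.E) = d := (hND.card_of_isVert hu').trans hd
  have h4 : #((Q.perturb ε).tight u' \ Q.E) + #Q.E = _ :=
    card_sdiff_add_card_eq_card (E_subset_tight hu'.1 : Q.E ⊆ (Q.perturb ε).tight u')
  have h5 := card_compl_add_card Q.E
  have h6 := card_le_univ S
  refine (SimpleGraph.edist_le q).trans ?_
  exact_mod_cast (by omega : q.length ≤ n - d)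

end HirschConj

theorem theorem3p6 :
    List.TFAE [HirschConj.HirschConjecture, HirschConj.NonRevisitingConjecture,
      HirschConj.DStepConjecture] := by
  tfae_have 1 → 3 := HirschConj.dStepConjecture_of_hirschConjecture
  tfae_have 3 → 2 := HirschConj.nonRevisitingConjecture_of_dStepConjecture
  tfae_have 2 → 1 := HirschConj.hirschConjecture_of_nonRevisitingConjecture
  tfae_finish
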